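/- **Theorem 6.5.** *Notation.* Let $(\Omega,\mathcal F,\mathbb P)$ be a probability space. For a real random variable $X$ put $\|X\|_{\psi_2}=\inf\{C>0:\ \mathbb E(\exp((|X|/C)^2)-1)\le 1\}$; $X$ is subgaussian if $\|X\|_{\psi_2}<\infty$. For a complex $m\times n$ matrix $A$ let $\|A\|_{S^q}=(\operatorname{Tr}(A^*A)^{q/2})^{1/q}$ for $1\le q<\infty$ and let $\|A\|_{S^\infty}$ be the operator norm $\ell^2_n\to\ell^2_m$. For a set $\mathcal A$ of such matrices put $\Delta_q(\mathcal A)=\sup_{A\in\mathcal A}\|A\|_{S^q}$, and let $d_\infty(A,B)=\|A-B\|_{S^\infty}$. A sequence $(\mathcal A_k)_{k\ge 0}$ of subsets of $\mathcal A$ is admissible if $|\mathcal A_0|=1$ and $|\mathcal A_k|\le 2^{2^k}$ for $k\ge 1$. For $1\le p<\infty$ put $$\gamma_{2,p}(\mathcal A,d_\infty)=\inf_{(\mathcal A_k)}\ \sup_{A\in\mathcal A}\ \sum_{k\ge\lfloor\log_2 p\rfloor}2^{k/2}\,d_\infty(A,\mathcal A_k),\qquad \gamma_2(\mathcal A,d_\infty)=\gamma_{2,1}(\mathcal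 A,d_\infty),$$ where the infimum is over admissible sequences and $d_\infty(A,\mathcal A_k)=\inf_{B\in\mathcal A_k}d_\infty(A,B)$. All these quantities take values in $[0,\infty]$, with $0\cdot\infty=0$ and $\inf\emptyset=\infty$. *Statement.* There are universal constants $C_0,c,C>0$ such that the following holds. Let $\mathcal A$ be a set of complex $m\times n$ matrices, let $\xi_1,\dots,\xi_n$ be independent, real-valued, mean-zero, subgaussian random variables on $(\Omega,\mathcal F,\mathbb P)$, let $\xi=(\xi_1,\dots,\xi_n)$ and $\|\xi\|_{\psi_2}=\max_i\|\xi_i\|_{\psi_2}$. (a) For every $1\le p<\infty$, $$\Big(\mathbb E\sup_{A\in\mathcal A}\Big|\|A\xi\|_2^2-\mathbb E\|A\xi\|_2^2\Big|^p\Big)^{1/p}\le C_0\|\xi\|_{\psi_2}^2\Big(\gamma_{2,p}^2(\mathcal A,d_\infty)+\Delta_2(\mathcal A)\gamma_{2,p}(\mathcal A,d_\infty)+\sqrt p\,\Delta_4^2(\mathcal A)+p\,\Delta_\infty^2(\mathcal A)\Big).$$ (b) Suppose moreover that $\gamma_2(\mathcal A,d_\infty)<\infty$ (automatic if $\mathcal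 A$ is finite and non-empty), that $\mathcal A$ contains a non-zero matrix, and that some $\xi_i$ is not almost surely zero. Then for every $u\ge 1$, $$\mathbb P\Big(\sup_{A\in\mathcal A}\Big|\|A\xi\|_2^2-\mathbb E\|A\xi\|_2^2\Big|\ge C\|\xi\|_{\psi_2}^2\big(\gamma_2^2(\mathcal A,d_\infty)+\Delta_2(\mathcal A)\gamma_2(\mathcal A,d_\infty)\big)+c\|\xi\|_{\psi_2}^2\big(\sqrt u\,\Delta_4^2(\mathcal A)+u\,\Delta_\infty^2(\mathcal A)\big)\Big)\le e^{-u}.$$ -/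

import Mathlib

open MeasureTheory ProbabilityTheory
open scoped ENNReal Matrix

noncomputable section

namespace Chaos

/-- The Orlicz (quasi-)norm `‖X‖_{ψ_α} = inf {C > 0 : E (exp ((|X| / C) ^ α) - 1) ≤ 1}`, with
value `∞` if there is no such `C`. -/
def psiNorm {Ω : Type*} [MeasurableSpace Ω] (P : Measure Ω) (α : ℝ) (X : Ω → ℝ) : ℝ≥0∞ :=
  ⨅ (C : ℝ) (_ : 0 < C)
    (_ : ∫⁻ ω, ENNReal.ofReal (Real.exp ((|X ω| / C) ^ α) - 1) ∂P ≤ 1), ENNReal.ofReal C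

/-- `‖ξ‖_{ψ_2} = max_i ‖ξ_i‖_{ψ_2}`. -/
def psiTwoVec {Ω : Type*} [MeasurableSpace Ω] (P : Measure Ω) {n : ℕ} (ξ : Fin n → Ω → ℝ) :
    ℝ≥0∞ :=
  ⨆ i, psiNorm P 2 (ξ i)

/-- A sequence of subsets of `S` with `|T_0| = 1` and `|T_k| ≤ 2 ^ (2 ^ k)` for `k ≥ 1`. -/
structure IsAdmissible {M : Type*} (S : Set M) (T : ℕ → Set M) : Prop where
  subset : ∀ k, T k ⊆ S
  card_zero : (T 0).encard = 1
  card_le : ∀ k, 1 ≤ k → (T k).encard ≤ ((2 ^ 2 ^ k : ℕ) : ℕ∞)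

/-- The distance `d(t, U) = inf_{s ∈ U} d(t, s)`, which is `∞` for empty `U`. -/
def distTo {M : Type*} (d : M → M → ℝ) (t : M) (U : Set M) : ℝ≥0∞ :=
  ⨅ s ∈ U, ENNReal.ofReal (d t s)

/-- Talagrand's functional `γ_α(S, d)`. -/
def gammaFun {M : Type*} (α : ℝ) (d : M → M → ℝ) (S : Set M) : ℝ≥0∞ :=
  ⨅ (T : ℕ → Set M) (_ : IsAdmissible S T),
    ⨆ t ∈ S, ∑' k : ℕ, (2 : ℝ≥0∞) ^ ((k : ℝ) / α) * distTo d t (T k)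

/-- The truncated functional `γ_{α,p}(S, d)`, in which the sum runs over `k ≥ ⌊log₂ p⌋`. -/
def gammaTrunc {M : Type*} (α p : ℝ) (d : M → M → ℝ) (S : Set M) : ℝ≥0∞ :=
  ⨅ (T : ℕ → Set M) (_ : IsAdmissible S T),
    ⨆ t ∈ S, ∑' k : Set.Ici ⌊Real.logb 2 p⌋₊,
      (2 : ℝ≥0∞) ^ (((k : ℕ) : ℝ) / α) * distTo d t (T k)

/-- The Schatten norm `‖A‖_{S^q}`: for finite `q` it is `(Tr (A* A) ^ (q / 2)) ^ (1 / q)`, the power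
of the positive semidefinite matrix being taken in the functional calculus, and for `q = ∞` it is
the operator norm from `ℓ²` to `ℓ²`. -/
def schattenNorm {m n : ℕ} (q : ℝ≥0∞) (A : Matrix (Fin m) (Fin n) ℂ) : ℝ :=
  if q = ∞ then ‖LinearMap.toContinuousLinearMap (Matrix.toEuclideanLin A)‖
  else (cfc (fun x : ℝ => x ^ (q.toReal / 2)) (Aᴴ * A)).trace.re ^ (1 / q.toReal)

/-- The metric `d_q(A, B) = ‖A - B‖_{S^q}`. -/
def schattenDist {m n : ℕ} (q : ℝ≥0∞) (A B : Matrix (Fin m) (Fin n) ℂ) : ℝ :=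
  schattenNorm q (A - B)

/-- The radius `Δ_q(𝒜) = sup_{A ∈ 𝒜} ‖A‖_{S^q}`. -/
def radius {m n : ℕ} (q : ℝ≥0∞) (𝒜 : Set (Matrix (Fin m) (Fin n) ℂ)) : ℝ≥0∞ :=
  ⨆ A ∈ 𝒜, ENNReal.ofReal (schattenNorm q A)

/-- The random variable `‖A ξ‖_2 ^ 2`. -/
def sqNorm {Ω : Type*} {m n : ℕ} (ξ : Fin n → Ω → ℝ) (A : Matrix (Fin m) (Fin n) ℂ) (ω : Ω) : ℝ :=
  ‖WithLp.toLp 2 (A *ᵥ fun j => (ξ j ω : ℂ))‖ ^ 2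

/-- The random variable `sup_{A ∈ 𝒜} |‖A ξ‖_2 ^ 2 - E ‖A ξ‖_2 ^ 2|`. -/
def supDev {Ω : Type*} [MeasurableSpace Ω] (P : Measure Ω) {m n : ℕ} (ξ : Fin n → Ω → ℝ)
    (𝒜 : Set (Matrix (Fin m) (Fin n) ℂ)) (ω : Ω) : ℝ≥0∞ :=
  ⨆ A ∈ 𝒜, ENNReal.ofReal |sqNorm ξ A ω - ∫ ω', sqNorm ξ A ω' ∂P|

end Chaos

end

/-! ### Comparison of laws through kernels and Jensen's inequality -/

noncomputable section

namespace Chaos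

/-! The variables are replaced by Gaussians, and the decoupled Gaussian chaos is then chained.

Replacement. Scale so that `E exp (X ^ 2) ≤ 2` and treat the pair `(X, X ^ 2 - E X ^ 2)` as a single
variable. Off the diagonal the chaos is bilinear in distinct indices, and on the diagonal it is
linear in the centred squares. It is therefore affine in each pair, so the `p`-th power of the
supremum of its absolute values satisfies Jensen's inequality in each pair. It remains to realise
the pair as a conditional expectation of the Gaussian pair `(25 g, 625 (g ^ 2 - 1))`. For each value
`t` of `X`, a tilted Gaussian density of mass below one has the right barycentre. It is at most `exp
(t ^ 2) / 2`, so these densities average to at most one, and the missing mass is filled in by a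
product kernel (`lintegral_comp_le_of_density`, `lintegral_le_gaussian`). Replacing one coordinate
at a time gives `lintegral_iSup_le_gaussian`.

Gaussian chaos. Subtracting an independent copy and rotating by `π / 4` turns the deviation into `2
⟨A g, A g'⟩` (`lpN_dev_le_bilin`). Along a chain of nearest points, the increments are `⟨(A_{j+1} -
A_j) g, A_{j+1} g'⟩` and a mirror term. With one Gaussian vector frozen each is a linear form in the
other, of size `d_∞` times `N = sup ‖A g'‖`, so chaining from level `⌊log₂ p⌋` costs `γ_{2,p}` times
the `p`-th moment norm of `N`. The starting level has at most `2 ^ p` points and costs a factor `2`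
on the moment of one matrix, which is of order `√p ‖A‖_{S^4} ^ 2 + p ‖A‖_{S^∞} ^ 2`
(`lpN_bilin_iSup_le`). Finally `N ^ 2` is at most `Δ_2 ^ 2` plus the deviation, so the moment of `N`
satisfies a quadratic inequality, and solving it closes the bound (`lpN_dev_iSup_le`).

The tail bound is Markov's inequality with `p = u`. -/

/-- Functions satisfying Jensen's inequality for every probability measure with a mean. -/
def IsJensen {V : Type*} [NormedAddCommGroup V] [NormedSpace ℝ V] [MeasurableSpace V]
    (φ : V → ℝ≥0∞) : Prop :=
  ∀ ρ : Measure V, IsProbabilityMeasure ρ → Integrable id ρ →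
    φ (∫ v, v ∂ρ) ≤ ∫⁻ v, φ v ∂ρ

/-- Comparison of `z` under `ν` with `Z` under `γ` for functions satisfying Jensen's inequality:
it suffices to realise each `z t` as the barycentre of a sub-probability density `J t` in such a
way that the densities average to at most one. -/
lemma lintegral_comp_le_of_density {T X V : Type*} [MeasurableSpace T] [MeasurableSpace X]
    [NormedAddCommGroup V] [NormedSpace ℝ V] [CompleteSpace V] [MeasurableSpace V] [BorelSpace V]
    [SecondCountableTopology V]
    {ν : Measure T} {γ : Measure X} [IsProbabilityMeasure ν] [IsProbabilityMeasure γ]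
    {z : T → V} {Z : X → V} {J : T → X → ℝ} {w : T → ℝ} {φ : V → ℝ≥0∞}
    (hφ : IsJensen φ) (hφm : Measurable φ) (hZm : Measurable Z)
    (hZ : Integrable Z γ) (hZ0 : ∫ x, Z x ∂γ = 0) (hz0 : ∫ t, z t ∂ν = 0)
    (hJm : Measurable (Function.uncurry J)) (hJ0 : ∀ t x, 0 ≤ J t x)
    (hJ : Integrable (Function.uncurry J) (ν.prod γ))
    (hJZ : Integrable (Function.uncurry fun t x => J t x • Z x) (ν.prod γ))
    (hJt : ∀ t, Integrable (J t) γ) (hJZt : ∀ t, Integrable (fun x => J t x • Z x) γ)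
    (hJx : ∀ x, Integrable (fun t => J t x) ν)
    (hw : ∀ t, ∫ x, J t x ∂γ = w t) (hw1 : ∀ t, w t < 1)
    (hzJ : ∀ t, ∫ x, J t x • Z x ∂γ = z t) (hH : ∀ x, ∫ t, J t x ∂ν ≤ 1) :
    ∫⁻ t, φ (z t) ∂ν ≤ ∫⁻ x, φ (Z x) ∂γ := by
  set H : X → ℝ := fun x => ∫ t, J t x ∂ν with hHdef
  set W : ℝ := ∫ t, w t ∂ν with hWdef
  have hH0 : ∀ x, 0 ≤ H x := fun x => integral_nonneg fun t => hJ0 t x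
  have hwint : Integrable w ν := by
    have := hJ.integral_prod_left
    simpa [Function.uncurry, hw] using this
  have hHint : Integrable H γ := hJ.integral_prod_right
  have hHm : Measurable H :=
    (StronglyMeasurable.integral_prod_left' (f := Function.uncurry J) (μ := ν)
      hJm.stronglyMeasurable).measurable
  have hwm : Measurable w := by
    have : w = fun t => ∫ x, J t x ∂γ := by ext t; rw [hw]
    rw [this]
    exact (StronglyMeasurable.integral_prod_right' (f := Function.uncurry J) (ν := γ)
      hJm.stronglyMeasurable).measurable
  have h1w : Integrable (fun t => 1 - w t) ν := (integrable_const (1 : ℝ)).sub hwint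
  have h1H : Integrable (fun x => 1 - H x) γ := (integrable_const (1 : ℝ)).sub hHint
  have hW1 : W < 1 := by
    have h1 : 0 < ∫ t, (1 - w t) ∂ν := by
      rw [integral_pos_iff_support_of_nonneg (fun t => by simpa using (hw1 t).le) h1w]
      have : Function.support (fun t => 1 - w t) = Set.univ := by
        ext t; simpa [Function.mem_support] using (sub_pos.2 (hw1 t)).ne'
      rw [this]; simp
    rw [integral_sub (integrable_const 1) hwint] at h1
    simp at h1
    linarith
  have hHW : ∫ x, H x ∂γ = W := by
    rw [hHdef, hWdef]
    simp_rw [← hw]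
    exact (integral_integral_swap hJ).symm
  have hHZint : Integrable (fun x => H x • Z x) γ := by
    refine hZ.norm.mono' (hHm.aestronglyMeasurable.smul hZ.aestronglyMeasurable)
      (ae_of_all _ fun x => ?_)
    rw [norm_smul, Real.norm_of_nonneg (hH0 x)]
    exact mul_le_of_le_one_left (norm_nonneg _) (hH x)
  have hHZ : ∫ x, H x • Z x ∂γ = 0 := by
    have h1 : ∀ x, H x • Z x = ∫ t, J t x • Z x ∂ν := fun x => (integral_smul_const _ _).symm
    simp_rw [h1]
    rw [← integral_integral_swap hJZ]
    simp_rw [hzJ]; exact hz0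
  -- The deficits `1 - w` and `1 - H` are filled in as a product, which makes `k` doubly stochastic.
  -- The added part leaves the barycentre unchanged: `Z` is centred and `∫ H Z = ∫ z = 0`, so `∫ (1
  -- - H) Z = 0`.
  set k : T → X → ℝ := fun t x => J t x + (1 - w t) * ((1 - H x) / (1 - W)) with hk
  have hk0 : ∀ t x, 0 ≤ k t x := fun t x =>
    add_nonneg (hJ0 t x) (mul_nonneg (sub_nonneg.2 (hw1 t).le)
      (div_nonneg (sub_nonneg.2 (hH x)) (sub_pos.2 hW1).le))
  have hkm : Measurable (Function.uncurry k) := by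
    refine hJm.add (((measurable_const.sub (hwm.comp measurable_fst))).mul
      ((measurable_const.sub (hHm.comp measurable_snd)).div_const _))
  have hkt : ∀ t, Integrable (k t) γ := fun t =>
    (hJt t).add ((h1H.div_const _).const_mul _)
  have hW1' : 1 - W ≠ 0 := (sub_pos.2 hW1).ne'
  have hkt1 : ∀ t, ∫ x, k t x ∂γ = 1 := fun t => by
    simp only [hk]
    rw [integral_add (hJt t) ((h1H.div_const _).const_mul _), hw,
      integral_const_mul, integral_div, integral_sub (integrable_const 1) hHint, hHW]
    simp [div_self hW1']
  have hkZ : ∀ t, Integrable (fun x => k t x • Z x) γ ∧ ∫ x, k t x • Z x ∂γ = z t := fun t => by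
    have e : (fun x => k t x • Z x) = fun x => J t x • Z x +
        ((1 - w t) / (1 - W)) • (Z x - H x • Z x) := by
      ext x
      simp only [hk]
      rw [add_smul, show (1 - w t) * ((1 - H x) / (1 - W)) = ((1 - w t) / (1 - W)) * (1 - H x) by
        ring, mul_smul, sub_smul _ (H x), one_smul]
    rw [e]
    have hI : Integrable (fun x => ((1 - w t) / (1 - W)) • (Z x - H x • Z x)) γ :=
      (hZ.sub hHZint).smul _
    refine ⟨(hJZt t).add hI, ?_⟩
    rw [integral_add (hJZt t) hI, hzJ, integral_smul,
      integral_sub hZ hHZint, hZ0, hHZ]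
    simp
  have hkx : ∀ x, ∫⁻ t, ENNReal.ofReal (k t x) ∂ν = 1 := fun x => by
    have hi : Integrable (fun t => k t x) ν :=
      (hJx x).add (h1w.mul_const _)
    rw [← ofReal_integral_eq_lintegral_ofReal hi (ae_of_all _ fun t => hk0 t x)]
    have : ∫ t, k t x ∂ν = 1 := by
      simp only [hk]
      rw [integral_add (hJx x) (h1w.mul_const _),
        integral_mul_const, integral_sub (integrable_const 1) hwint]
      simp only [integral_const, probReal_univ, smul_eq_mul, one_mul]
      rw [mul_div_cancel₀ _ hW1']; ring
    rw [this, ENNReal.ofReal_one]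
  have hmain : ∀ t, φ (z t) ≤ ∫⁻ x, ENNReal.ofReal (k t x) * φ (Z x) ∂γ := fun t => by
    have hktm : Measurable (k t) := hkm.comp (measurable_const.prodMk measurable_id)
    set ρ₀ := γ.withDensity fun x => ENNReal.ofReal (k t x) with hρ₀
    have hint : ∀ {f : X → V}, ∫ x, f x ∂ρ₀ = ∫ x, k t x • f x ∂γ := fun {f} => by
      rw [hρ₀, integral_withDensity_eq_integral_toReal_smul hktm.ennreal_ofReal
        (ae_of_all _ fun _ => ENNReal.ofReal_lt_top)]
      simp [ENNReal.toReal_ofReal (hk0 t _)]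
    have hprob : IsProbabilityMeasure ρ₀ := ⟨by
      rw [hρ₀, withDensity_apply _ MeasurableSet.univ, setLIntegral_univ,
        ← ofReal_integral_eq_lintegral_ofReal (hkt t) (ae_of_all _ (hk0 t)), hkt1,
        ENNReal.ofReal_one]⟩
    have hp2 : IsProbabilityMeasure (ρ₀.map Z) := Measure.isProbabilityMeasure_map hZm.aemeasurable
    have hI : Integrable Z ρ₀ := by
      rw [hρ₀, integrable_withDensity_iff_integrable_smul' hktm.ennreal_ofReal
        (ae_of_all _ fun _ => ENNReal.ofReal_lt_top)]
      simpa [ENNReal.toReal_ofReal (hk0 t _)] using (hkZ t).1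
    have := hφ (ρ₀.map Z) hp2 ((integrable_map_measure aestronglyMeasurable_id
      hZm.aemeasurable).2 hI)
    rw [lintegral_map hφm hZm, integral_map (f := fun v => v) hZm.aemeasurable
      aestronglyMeasurable_id] at this
    simp only [hint, (hkZ t).2] at this
    rwa [hρ₀, lintegral_withDensity_eq_lintegral_mul _ hktm.ennreal_ofReal
      (g := fun x => φ (Z x)) (hφm.comp hZm)] at this
  calc ∫⁻ t, φ (z t) ∂ν ≤ ∫⁻ t, ∫⁻ x, ENNReal.ofReal (k t x) * φ (Z x) ∂γ ∂ν :=
        lintegral_mono hmain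
    _ = ∫⁻ x, ∫⁻ t, ENNReal.ofReal (k t x) * φ (Z x) ∂ν ∂γ :=
        lintegral_lintegral_swap
          ((hkm.ennreal_ofReal.mul (hφm.comp (hZm.comp measurable_snd))).aemeasurable)
    _ = ∫⁻ x, φ (Z x) ∂γ := by
        refine lintegral_congr fun x => ?_
        have hm : Measurable fun t => k t x := hkm.comp (measurable_id.prodMk measurable_const)
        rw [lintegral_mul_const _ hm.ennreal_ofReal, hkx, one_mul]

lemma rpow_lintegral_le {X : Type*} [MeasurableSpace X] {ρ : Measure X} [IsProbabilityMeasure ρ]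
    {f : X → ℝ≥0∞} (hf : AEMeasurable f ρ) {p : ℝ} (hp : 1 ≤ p) :
    (∫⁻ x, f x ∂ρ) ^ p ≤ ∫⁻ x, f x ^ p ∂ρ := by
  have h := eLpNorm'_le_eLpNorm'_of_exponent_le (p := 1) (q := p) (f := f) one_pos hp ρ
    hf.aestronglyMeasurable
  simp only [eLpNorm', enorm_eq_self, ENNReal.rpow_one, div_one] at h
  calc (∫⁻ x, f x ∂ρ) ^ p ≤ ((∫⁻ x, f x ^ p ∂ρ) ^ (1 / p)) ^ p := by gcongr
    _ = ∫⁻ x, f x ^ p ∂ρ := by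
      rw [← ENNReal.rpow_mul, one_div_mul_cancel (by positivity), ENNReal.rpow_one]

/-- Index sets may be uncountable, so measurability of the suprema is obtained from lower
semicontinuity, which every supremum of continuous functions has. -/
lemma lowerSemicontinuous_iSup_ofReal_abs {V ι : Type*} [TopologicalSpace V] (S : Set ι)
    {f : ι → V → ℝ} (hf : ∀ i, Continuous (f i)) :
    LowerSemicontinuous fun v => ⨆ i ∈ S, ENNReal.ofReal |f i v| :=
  lowerSemicontinuous_biSup fun i _ =>
    (ENNReal.continuous_ofReal.comp (hf i).abs).lowerSemicontinuous

/-- The `p`-th power of a supremum of absolute values of affine functionals. -/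
lemma isJensen_iSup_affine {V ι : Type*} [NormedAddCommGroup V] [NormedSpace ℝ V]
    [CompleteSpace V] [MeasurableSpace V] [BorelSpace V] (S : Set ι) (α : ι → ℝ)
    (L : ι → V →L[ℝ] ℝ) {p : ℝ} (hp : 1 ≤ p) :
    IsJensen fun v => (⨆ i ∈ S, ENNReal.ofReal |α i + L i v|) ^ p := by
  intro ρ hρ hint
  have hm : Measurable fun v => ⨆ i ∈ S, ENNReal.ofReal |α i + L i v| :=
    (lowerSemicontinuous_iSup_ofReal_abs S
      (f := fun i v => α i + L i v) fun i => by fun_prop).measurable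
  refine le_trans ?_ (rpow_lintegral_le hm.aemeasurable hp)
  refine ENNReal.rpow_le_rpow (iSup₂_le fun i hi => ?_) (by positivity)
  have hL : Integrable (fun v => L i v) ρ := (L i).integrable_comp hint
  have hI : Integrable (fun v => α i + L i v) ρ := (integrable_const _).add hL
  have h1 : α i + L i (∫ v, v ∂ρ) = ∫ v, (α i + L i v) ∂ρ := by
    rw [integral_add (integrable_const _) hL, (L i).integral_comp_comm (φ := fun v => v) hint]
    simp
  calc ENNReal.ofReal |α i + L i (∫ v, v ∂ρ)|
      ≤ ENNReal.ofReal (∫ v, |α i + L i v| ∂ρ) := by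
        rw [h1]; exact ENNReal.ofReal_le_ofReal (abs_integral_le_integral_abs)
    _ = ∫⁻ v, ENNReal.ofReal |α i + L i v| ∂ρ :=
        ofReal_integral_eq_lintegral_ofReal hI.abs (ae_of_all _ fun _ => abs_nonneg _)
    _ ≤ ∫⁻ v, ⨆ i ∈ S, ENNReal.ofReal |α i + L i v| ∂ρ :=
        lintegral_mono fun v => le_iSup₂ (f := fun i (_ : i ∈ S) => ENNReal.ofReal |α i + L i v|) i hi

end Chaos
end

/-! ### One-dimensional domination by a Gaussian via tilted densities -/

noncomputable section

namespace Chaos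

open scoped NNReal

/-- The dilation factor of the tilted Gaussians. -/
def dil (t : ℝ) : ℝ := 1 + 16 / (1 + t ^ 2)

/-- The variance of the tilted Gaussians. -/
def tiltVar (s t : ℝ) : ℝ := 1 - (dil t * s + t ^ 2 * dil t * (dil t - 1)) / 625

/-- The density of a normal law of mean `t * dil t / 25` and variance `tiltVar s t` with respect to
the standard normal law, divided by `dil t`. -/
def tiltDensity (s t x : ℝ) : ℝ :=
  (dil t)⁻¹ * ((√(tiltVar s t))⁻¹ *
    Real.exp (x ^ 2 / 2 - (x - t * dil t / 25) ^ 2 / (2 * tiltVar s t)))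

lemma one_lt_dil (t : ℝ) : 1 < dil t := by
  unfold dil; have : 0 < 16 / (1 + t ^ 2) := by positivity
  linarith

lemma dil_le (t : ℝ) : dil t ≤ 17 := by
  unfold dil
  have : 16 / (1 + t ^ 2) ≤ 16 := div_le_self (by norm_num) (by nlinarith [sq_nonneg t])
  linarith

lemma dil_sub_one_mul (t : ℝ) : (dil t - 1) * (1 + t ^ 2) = 16 := by
  unfold dil; field_simp; ring

lemma tiltVar_le (s t : ℝ) (hs : 0 ≤ s) : tiltVar s t ≤ 1 - t ^ 2 * dil t * (dil t - 1) / 625 := by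
  have := one_lt_dil t
  unfold tiltVar
  have : 0 ≤ dil t * s := by positivity
  linarith

/-- The two losses are at most `17` and `16 * 17 = 272`, and `289 / 625 < 1 / 2`; this is one use of
the size of the standard deviation `25`. -/
lemma half_le_tiltVar (s t : ℝ) (hs : s ≤ 1) : 1 / 2 ≤ tiltVar s t := by
  have h1 := one_lt_dil t
  have h2 := dil_le t
  have h3 := dil_sub_one_mul t
  have h4 : dil t * s ≤ 17 := by nlinarith
  have h5 : t ^ 2 * (dil t - 1) ≤ 16 := by nlinarith
  have h6 : t ^ 2 * dil t * (dil t - 1) ≤ 272 := by nlinarith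
  unfold tiltVar
  linarith

/-- The dilation `q > 1` lowers the variance to at most `1 - e`, so `1 / v ≥ 1 + e`. The surplus `e
* d ^ 2` absorbs the cross term between `d` and the mean by completing the square. The price `q / (q
- 1) = 1 + (1 + t ^ 2) / 16` grows slowly enough because `q - 1 = 16 / (1 + t ^ 2)`. The squared
mean is harmless thanks to the factor `1 / 625`. -/
lemma tilt_exponent_le (s t x : ℝ) (hs0 : 0 ≤ s) (hs : s ≤ 1) :
    x ^ 2 / 2 - (x - t * dil t / 25) ^ 2 / (2 * tiltVar s t) ≤ 1 + t ^ 2 / 2 := by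
  have h1 := one_lt_dil t
  have h3 := dil_sub_one_mul t
  have hv := half_le_tiltVar s t hs
  have hv2 := tiltVar_le s t hs0
  set q := dil t
  set v := tiltVar s t
  set e := t ^ 2 * q * (q - 1) / 625 with he
  set d := x - t * q / 25 with hd
  have he0 : 0 ≤ e := by
    have : 0 < q - 1 := by linarith
    have : 0 < q := by linarith
    positivity
  have hdiv : (1 + e) * d ^ 2 / 2 ≤ d ^ 2 / (2 * v) := by
    rw [div_le_div_iff₀ (by norm_num) (by linarith)]
    have : (1 + e) * v ≤ 1 := by nlinarith
    nlinarith [mul_le_mul_of_nonneg_left this (sq_nonneg d)]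
  have hx : x = d + t * q / 25 := by rw [hd]; ring
  have hm : (t * q / 25) ^ 2 ≤ (t ^ 2 + 96) / 625 := by
    have h5 : t ^ 2 * (q - 1) ≤ 16 := by nlinarith
    have h6 : t ^ 2 * (q - 1) ^ 2 ≤ 64 := by
      have e1 : t ^ 2 * (q - 1) ^ 2 * (1 + t ^ 2) ^ 2 = t ^ 2 * 256 := by
        rw [show t ^ 2 * (q - 1) ^ 2 * (1 + t ^ 2) ^ 2 = t ^ 2 * ((q - 1) * (1 + t ^ 2)) ^ 2 by ring,
          h3]; norm_num
      have e2 : t ^ 2 * 256 ≤ 64 * (1 + t ^ 2) ^ 2 := by nlinarith [sq_nonneg (t ^ 2 - 1)]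
      rw [← e1] at e2
      exact le_of_mul_le_mul_right e2 (by positivity)
    have : (t * q / 25) ^ 2 = (t ^ 2 + 2 * (t ^ 2 * (q - 1)) + t ^ 2 * (q - 1) ^ 2) / 625 := by ring
    rw [this]
    linarith
  have hr : 2 * d * (t * q / 25) ≤ e * d ^ 2 + (1 + (1 + t ^ 2) / 16) := by
    have hq : 1 + (1 + t ^ 2) / 16 = q / (q - 1) := by
      rw [eq_div_iff (by linarith)]; linear_combination (1 / 16 : ℝ) * h3
    rw [hq]
    have : e * d ^ 2 + q / (q - 1) - 2 * d * (t * q / 25)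
        = q / (q - 1) * (d * t / 25 * (q - 1) - 1) ^ 2 := by
      have : q - 1 ≠ 0 := by linarith
      rw [he]; field_simp; ring
    have h7 : 0 ≤ q / (q - 1) * (d * t / 25 * (q - 1) - 1) ^ 2 :=
      mul_nonneg (div_nonneg (by linarith) (by linarith)) (sq_nonneg _)
    linarith
  have : x ^ 2 = d ^ 2 + 2 * d * (t * q / 25) + (t * q / 25) ^ 2 := by rw [hx]; ring
  nlinarith [sq_nonneg t]

lemma tiltDensity_nonneg (s t x : ℝ) : 0 ≤ tiltDensity s t x := by
  have := one_lt_dil t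
  unfold tiltDensity
  positivity

/-- One factor `exp (t ^ 2 / 2)` pays for the exponent and another for `1 / q`, which is small near
`t = 0`. The remaining constants multiply to `2 / 17 * 1.42 * 2.72 < 1 / 2`. -/
lemma tiltDensity_le (s t x : ℝ) (hs0 : 0 ≤ s) (hs : s ≤ 1) :
    tiltDensity s t x ≤ Real.exp (t ^ 2) / 2 := by
  have h1 := one_lt_dil t
  have h3 := dil_sub_one_mul t
  have hv := half_le_tiltVar s t hs
  have hq : (dil t)⁻¹ ≤ (2 / 17) * Real.exp (t ^ 2 / 2) := by
    have : (1 + t ^ 2 / 2) ≤ Real.exp (t ^ 2 / 2) := by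
      have := Real.add_one_le_exp (t ^ 2 / 2); linarith
    have h2 : (dil t)⁻¹ ≤ (2 / 17) * (1 + t ^ 2 / 2) := by
      rw [inv_le_iff_one_le_mul₀ (by linarith)]
      nlinarith [sq_nonneg t]
    exact h2.trans (by gcongr)
  have hs2 : (√(tiltVar s t))⁻¹ ≤ 1.42 := by
    rw [inv_le_iff_one_le_mul₀ (by positivity)]
    have h4 : (1 / 1.42 : ℝ) ≤ √(tiltVar s t) := by
      apply Real.le_sqrt_of_sq_le; norm_num at hv ⊢; linarith
    have : (1.42 : ℝ) * (1 / 1.42) ≤ 1.42 * √(tiltVar s t) := by gcongr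
    norm_num at this ⊢; linarith
  have he := Real.exp_le_exp.2 (tilt_exponent_le s t x hs0 hs)
  have he1 : Real.exp (1 + t ^ 2 / 2) ≤ 2.72 * Real.exp (t ^ 2 / 2) := by
    rw [Real.exp_add]
    have := Real.exp_one_lt_d9
    gcongr; linarith
  have hee : Real.exp (t ^ 2 / 2) * Real.exp (t ^ 2 / 2) = Real.exp (t ^ 2) := by
    rw [← Real.exp_add]; ring_nf
  unfold tiltDensity
  calc _ ≤ ((2 / 17) * Real.exp (t ^ 2 / 2)) * (1.42 * (2.72 * Real.exp (t ^ 2 / 2))) := by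
        have := he.trans he1
        gcongr
    _ = (2 / 17 * 1.42 * 2.72) * Real.exp (t ^ 2) := by rw [← hee]; ring
    _ ≤ _ := by
        have := Real.exp_pos (t ^ 2)
        norm_num
        linarith

lemma measurable_tiltDensity (s : ℝ) : Measurable (Function.uncurry (tiltDensity s)) := by
  unfold tiltDensity tiltVar dil Function.uncurry
  fun_prop

/-- Integration against the tilted density. -/
lemma integral_tiltDensity_smul {V : Type*} [NormedAddCommGroup V] [NormedSpace ℝ V] (s t : ℝ)
    (hs : s ≤ 1) (f : ℝ → V) :
    ∫ x, tiltDensity s t x • f x ∂(gaussianReal 0 1) =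
      (dil t)⁻¹ • ∫ x, f x ∂(gaussianReal (t * dil t / 25) (tiltVar s t).toNNReal) := by
  have hv : 0 < tiltVar s t := by have := half_le_tiltVar s t hs; linarith
  have hv' : (tiltVar s t).toNNReal ≠ 0 := by simpa using hv
  rw [integral_gaussianReal_eq_integral_smul one_ne_zero,
    integral_gaussianReal_eq_integral_smul hv', ← integral_smul]
  congr 1
  ext x
  rw [smul_smul, smul_smul]
  congr 1
  have h2π : (0 : ℝ) < 2 * Real.pi := by positivity
  rw [gaussianPDFReal, gaussianPDFReal, Real.coe_toNNReal _ hv.le, tiltDensity]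
  simp only [NNReal.coe_one, mul_one, sub_zero]
  rw [Real.sqrt_mul h2π.le, mul_inv]
  rw [show x ^ 2 / 2 - (x - t * dil t / 25) ^ 2 / (2 * tiltVar s t) =
    x ^ 2 / 2 + -(x - t * dil t / 25) ^ 2 / (2 * tiltVar s t) by ring, Real.exp_add]
  have : Real.exp (-x ^ 2 / 2) * Real.exp (x ^ 2 / 2) = 1 := by
    rw [← Real.exp_add]; ring_nf; simp
  linear_combination (√(2 * Real.pi))⁻¹ * (dil t)⁻¹ * (√(tiltVar s t))⁻¹ *
    Real.exp (-(x - t * dil t / 25) ^ 2 / (2 * tiltVar s t)) * this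

lemma integrable_id_gaussian (m : ℝ) (v : ℝ≥0) : Integrable (fun x => x) (gaussianReal m v) :=
  (memLp_id_gaussianReal (μ := m) (v := v) 1).integrable (by simp)

lemma integrable_sq_gaussian (m : ℝ) (v : ℝ≥0) : Integrable (fun x => x ^ 2) (gaussianReal m v) :=
  (memLp_id_gaussianReal (μ := m) (v := v) 2).integrable_sq

lemma integral_sq_gaussian (m : ℝ) (v : ℝ≥0) :
    ∫ x, x ^ 2 ∂(gaussianReal m v) = m ^ 2 + v := by
  have h := variance_eq_sub (memLp_id_gaussianReal (μ := m) (v := v) 2)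
  rw [variance_id_gaussianReal] at h
  simp only [Pi.pow_apply, id] at h
  rw [integral_id_gaussianReal] at h
  linarith

set_option maxHeartbeats 400000 in
/-- A centred law with `E exp (X ^ 2) ≤ 2` is dominated, jointly with its centred square, by a
Gaussian law of standard deviation `25`. -/
lemma lintegral_le_gaussian {ν : Measure ℝ} [IsProbabilityMeasure ν]
    (hexp : ∫⁻ t, ENNReal.ofReal (Real.exp (t ^ 2)) ∂ν ≤ 2) (hmean : ∫ t, t ∂ν = 0)
    {φ : ℝ × ℝ → ℝ≥0∞} (hφ : IsJensen φ) (hφm : Measurable φ) :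
    ∫⁻ t, φ (t, t ^ 2 - ∫ u, u ^ 2 ∂ν) ∂ν ≤
      ∫⁻ x, φ (25 * x, 625 * (x ^ 2 - 1)) ∂(gaussianReal 0 1) := by
  set s : ℝ := ∫ u, u ^ 2 ∂ν with hs
  have hexpm : Measurable fun t : ℝ => Real.exp (t ^ 2) := by fun_prop
  have hexpI : Integrable (fun t : ℝ => Real.exp (t ^ 2)) ν := by
    refine ⟨hexpm.aestronglyMeasurable (μ := ν), ?_⟩
    rw [hasFiniteIntegral_iff_ofReal (ae_of_all _ fun _ => (Real.exp_pos _).le)]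
    exact hexp.trans_lt (by norm_num)
  have hexp2 : ∫ t, Real.exp (t ^ 2) ∂ν ≤ 2 := by
    rw [integral_eq_lintegral_of_nonneg_ae (ae_of_all _ fun _ => (Real.exp_pos _).le)
      hexpm.aestronglyMeasurable]
    exact ENNReal.toReal_le_of_le_ofReal (by norm_num) (by simpa using hexp)
  have hsqI : Integrable (fun t : ℝ => t ^ 2) ν :=
    hexpI.mono' (by fun_prop) (ae_of_all _ fun t => by
      rw [Real.norm_of_nonneg (sq_nonneg t)]
      have := Real.add_one_le_exp (t ^ 2); linarith)
  have hidI : Integrable (fun t : ℝ => t) ν :=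
    hexpI.mono' (by fun_prop) (ae_of_all _ fun t => by
      have := Real.add_one_le_exp (t ^ 2)
      rw [Real.norm_eq_abs]
      have h2 := sq_abs t
      nlinarith [sq_nonneg (|t| - 1)])
  have hs0 : 0 ≤ s := integral_nonneg fun t => sq_nonneg t
  -- Since `t ^ 2 ≤ exp (t ^ 2) - 1`, the variance is at most `2 - 1`.
  have hs1 : s ≤ 1 := by
    have : ∫ t, t ^ 2 ∂ν ≤ ∫ t, (Real.exp (t ^ 2) - 1) ∂ν :=
      integral_mono hsqI (hexpI.sub (integrable_const 1)) fun t => by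
        have := Real.add_one_le_exp (t ^ 2)
        simp only; linarith
    rw [integral_sub hexpI (integrable_const 1)] at this
    simp at this
    linarith
  clear_value s
  set Z : ℝ → ℝ × ℝ := fun x => (25 * x, 625 * (x ^ 2 - 1)) with hZ
  have hZm : Measurable Z := by fun_prop
  have hZ1 : ∀ m v, Integrable (fun x : ℝ => 25 * x) (gaussianReal m v) := fun m v =>
    (integrable_id_gaussian m v).const_mul 25
  have hZ2 : ∀ m v, Integrable (fun x : ℝ => 625 * (x ^ 2 - 1)) (gaussianReal m v) := fun m v =>
    ((integrable_sq_gaussian m v).sub (integrable_const 1)).const_mul 625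
  have hZI : ∀ m v, Integrable Z (gaussianReal m v) := fun m v => (hZ1 m v).prodMk (hZ2 m v)
  have hZint : ∀ m v, ∫ x, Z x ∂(gaussianReal m v) = (25 * m, 625 * (m ^ 2 + v - 1)) :=
    fun m v => by
      rw [hZ, integral_pair (hZ1 m v) (hZ2 m v), integral_const_mul, integral_const_mul,
        integral_sub (integrable_sq_gaussian m v) (integrable_const 1), integral_id_gaussianReal,
        integral_sq_gaussian]
      simp
  have hJm := measurable_tiltDensity s
  have hJmt : ∀ t, Measurable (tiltDensity s t) := fun t =>
    hJm.of_uncurry_left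
  have hexp2I : Integrable (fun t : ℝ => Real.exp (t ^ 2) / 2) ν := hexpI.div_const 2
  change ∫⁻ t, φ (t, t ^ 2 - s) ∂ν ≤ ∫⁻ x, φ (Z x) ∂(gaussianReal 0 1)
  refine lintegral_comp_le_of_density (z := fun t => (t, t ^ 2 - s)) (Z := Z) (γ := gaussianReal 0 1)
    (J := tiltDensity s) (w := fun t => (dil t)⁻¹) hφ hφm hZm
    ?_ ?_ ?_ hJm (tiltDensity_nonneg s) ?_ ?_ ?_ ?_ ?_ ?_ ?_ ?_ ?_
  · exact hZI 0 1
  · rw [hZint]; simp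
  · have hI : Integrable (fun t : ℝ => t ^ 2 - s) ν := hsqI.sub (integrable_const s)
    rw [integral_pair hidI hI, hmean,
      integral_sub hsqI (integrable_const s)]
    simp [← hs]
  · have hI : Integrable (fun z : ℝ × ℝ => Real.exp (z.1 ^ 2) / 2 * 1)
        (ν.prod (gaussianReal 0 1)) := hexp2I.mul_prod (integrable_const (1 : ℝ))
    refine hI.mono' hJm.aestronglyMeasurable (ae_of_all _ fun x => ?_)
    rw [Function.uncurry, Real.norm_of_nonneg (tiltDensity_nonneg s _ _), mul_one]
    exact tiltDensity_le s _ _ hs0 hs1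
  · have hI : Integrable (fun z : ℝ × ℝ => Real.exp (z.1 ^ 2) / 2 * ‖Z z.2‖)
        (ν.prod (gaussianReal 0 1)) := hexp2I.mul_prod (hZI 0 1).norm
    refine hI.mono' ?_ (ae_of_all _ fun x => ?_)
    · exact (hJm.smul (hZm.comp measurable_snd)).aestronglyMeasurable
    simp only [Function.uncurry]
    rw [norm_smul, Real.norm_of_nonneg (tiltDensity_nonneg s _ _)]
    gcongr
    exact tiltDensity_le s _ _ hs0 hs1
  · intro t
    refine (integrable_const (Real.exp (t ^ 2) / 2)).mono' (hJmt t).aestronglyMeasurable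
      (ae_of_all _ fun x => ?_)
    rw [Real.norm_of_nonneg (tiltDensity_nonneg s _ _)]
    exact tiltDensity_le s _ _ hs0 hs1
  · intro t
    refine ((hZI 0 1).norm.const_mul (Real.exp (t ^ 2) / 2)).mono'
      ((hJmt t).smul hZm).aestronglyMeasurable (ae_of_all _ fun x => ?_)
    rw [norm_smul, Real.norm_of_nonneg (tiltDensity_nonneg s _ _)]
    gcongr
    exact tiltDensity_le s _ _ hs0 hs1
  · intro x
    refine hexp2I.mono' (Measurable.of_uncurry_right hJm).aestronglyMeasurable
      (ae_of_all _ fun t => ?_)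
    rw [Real.norm_of_nonneg (tiltDensity_nonneg s _ _)]
    exact tiltDensity_le s _ _ hs0 hs1
  · intro t
    have := integral_tiltDensity_smul s t hs1 (fun _ => (1 : ℝ))
    simpa using this
  · intro t
    exact inv_lt_one_of_one_lt₀ (one_lt_dil t)
  · intro t
    -- The mean `t q / 25` with weight `1 / q` gives first coordinate `t`. The variance `tiltVar` is
    -- the one solving `625 (m ^ 2 + v - 1) / q = t ^ 2 - s` for this mean.
    rw [integral_tiltDensity_smul s t hs1, hZint, Real.coe_toNNReal _
      (by have := half_le_tiltVar s t hs1; linarith)]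
    have h1 : dil t ≠ 0 := by have := one_lt_dil t; linarith
    ext
    · simp; field_simp
    · simp [tiltVar]; field_simp; ring
  · intro x
    -- The exponential moment enters here: the pointwise bound integrates to at most `2 / 2`.
    calc ∫ t, tiltDensity s t x ∂ν ≤ ∫ t, Real.exp (t ^ 2) / 2 ∂ν := by
          refine integral_mono_of_nonneg (ae_of_all _ fun t => tiltDensity_nonneg s t x) hexp2I
            (ae_of_all _ fun t => tiltDensity_le s t x hs0 hs1)
      _ ≤ 1 := by rw [integral_div]; linarith

end Chaos
end

/-! ### Tensorization and replacement in quadratic chaoses -/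

noncomputable section

namespace Chaos

/-- Comparison of product measures, one coordinate at a time. -/
lemma lintegral_pi_le_of_update {E : Type*} [MeasurableSpace E] {n : ℕ} {ν γ : Fin n → Measure E}
    [∀ i, IsProbabilityMeasure (ν i)] [∀ i, IsProbabilityMeasure (γ i)]
    {F : (Fin n → E) → ℝ≥0∞} (hF : Measurable F)
    (h : ∀ i x, ∫⁻ t, F (Function.update x i t) ∂(ν i) ≤ ∫⁻ t, F (Function.update x i t) ∂(γ i)) :
    ∫⁻ x, F x ∂(Measure.pi ν) ≤ ∫⁻ x, F x ∂(Measure.pi γ) := by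
  induction n with
  | zero => rw [Measure.pi_of_empty, Measure.pi_of_empty]
  | succ n ih =>
    have key : ∀ (μ : Fin (n + 1) → Measure E) [∀ i, IsProbabilityMeasure (μ i)],
        ∫⁻ x, F x ∂(Measure.pi μ) =
          ∫⁻ a, ∫⁻ y, F (Fin.cons a y) ∂(Measure.pi fun j : Fin n => μ j.succ) ∂(μ 0) := by
      intro μ _
      have := (measurePreserving_piFinSuccAbove μ 0).symm.lintegral_map_equiv F
      have hm : Measurable fun q => F ((MeasurableEquiv.piFinSuccAbove (fun _ => E) 0).symm q) :=
        hF.comp (MeasurableEquiv.measurable _)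
      rw [this, lintegral_prod _ hm.aemeasurable]
      simp [MeasurableEquiv.piFinSuccAbove, Fin.insertNthEquiv]
    have hm : Measurable fun q : E × (Fin n → E) => F (Fin.cons q.1 q.2 : Fin (n + 1) → E) := by
      refine hF.comp (measurable_pi_iff.2 fun i => ?_)
      refine Fin.cases ?_ (fun j => ?_) i
      · simpa using measurable_fst
      · simp only [Fin.cons_succ]
        fun_prop
    rw [key ν, key γ]
    calc ∫⁻ a, ∫⁻ y, F (Fin.cons a y) ∂(Measure.pi fun j : Fin n => ν j.succ) ∂(ν 0)
        ≤ ∫⁻ a, ∫⁻ y, F (Fin.cons a y) ∂(Measure.pi fun j : Fin n => γ j.succ) ∂(ν 0) := by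
          refine lintegral_mono fun a => ih (hm.comp measurable_prodMk_left) fun i x => ?_
          simpa only [Fin.cons_update] using h i.succ (Fin.cons a x)
      _ = ∫⁻ y, ∫⁻ a, F (Fin.cons a y) ∂(ν 0) ∂(Measure.pi fun j : Fin n => γ j.succ) :=
          lintegral_lintegral_swap hm.aemeasurable
      _ ≤ ∫⁻ y, ∫⁻ a, F (Fin.cons a y) ∂(γ 0) ∂(Measure.pi fun j : Fin n => γ j.succ) := by
          refine lintegral_mono fun y => ?_
          -- The hypothesis concerns updates of a complete vector, so some `e` must occupy
          -- coordinate `0` before it is overwritten.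
          by_cases hE : Nonempty E
          · obtain ⟨e⟩ := hE
            simpa only [Fin.update_cons_zero] using h 0 (Fin.cons e y)
          · have : IsEmpty E := not_nonempty_iff.1 hE
            rw [lintegral_of_isEmpty, lintegral_of_isEmpty]
      _ = _ := (lintegral_lintegral_swap hm.aemeasurable).symm

variable {H : Type*} [NormedAddCommGroup H] [InnerProductSpace ℝ H] {n : ℕ}

/-- The linear combination of the vectors `a j` with coefficients `x j`. -/
def act (a : Fin n → H) (x : Fin n → ℝ) : H := ∑ j, x j • a j

/-- The squared Hilbert-Schmidt norm of a family of columns. -/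
def hsSq (a : Fin n → H) : ℝ := ∑ j, ‖a j‖ ^ 2

/-- The quadratic chaos in which squares are treated as separate variables. -/
def chaosForm (a : Fin n → H) (z : Fin n → ℝ × ℝ) : ℝ :=
  ∑ j, ∑ k, inner ℝ (a j) (a k) * (if j = k then (z j).2 else (z j).1 * (z k).1)

lemma norm_act_sq (a : Fin n → H) (x : Fin n → ℝ) :
    ‖act a x‖ ^ 2 = ∑ j, ∑ k, inner ℝ (a j) (a k) * (x j * x k) := by
  rw [← real_inner_self_eq_norm_sq, act, sum_inner]
  refine Finset.sum_congr rfl fun j _ => ?_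
  rw [inner_sum]
  refine Finset.sum_congr rfl fun k _ => ?_
  rw [real_inner_smul_left, real_inner_smul_right]; ring

lemma norm_act_sq_sub (a : Fin n → H) (x s : Fin n → ℝ) :
    ‖act a x‖ ^ 2 - ∑ j, s j * ‖a j‖ ^ 2 = chaosForm a fun j => (x j, x j ^ 2 - s j) := by
  rw [norm_act_sq, chaosForm, ← Finset.sum_sub_distrib]
  refine Finset.sum_congr rfl fun j _ => ?_
  have : s j * ‖a j‖ ^ 2 = ∑ k, if j = k then s j * inner ℝ (a j) (a k) else 0 := by
    simp
  rw [this, ← Finset.sum_sub_distrib]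
  refine Finset.sum_congr rfl fun k _ => ?_
  by_cases h : j = k
  · subst h; simp; ring
  · simp [h]

lemma chaosForm_smul (a : Fin n → H) (z : Fin n → ℝ × ℝ) (c : ℝ) :
    chaosForm a (fun j => (c * (z j).1, c ^ 2 * (z j).2)) = c ^ 2 * chaosForm a z := by
  simp only [chaosForm, Finset.mul_sum]
  refine Finset.sum_congr rfl fun j _ => Finset.sum_congr rfl fun k _ => ?_
  split_ifs <;> ring

lemma continuous_chaosForm (a : Fin n → H) : Continuous (chaosForm a) := by
  unfold chaosForm
  refine continuous_finsetSum _ fun j _ => continuous_finsetSum _ fun k _ =>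
    continuous_const.mul ?_
  split_ifs <;> fun_prop

/-- Every monomial is either a single second component or a product of first components with
different indices, so no term is quadratic in the pair at `i`. This is what separating the squares
achieves. -/
lemma chaosForm_update (a : Fin n → H) (z : Fin n → ℝ × ℝ) (i : Fin n) :
    ∃ (α : ℝ) (L : ℝ × ℝ →L[ℝ] ℝ), ∀ v, chaosForm a (Function.update z i v) = α + L v := by
  have hsum : ∀ (f : Fin n → ℝ × ℝ → ℝ),
      (∀ j, ∃ (α : ℝ) (L : ℝ × ℝ →L[ℝ] ℝ), ∀ v, f j v = α + L v) →
      ∃ (α : ℝ) (L : ℝ × ℝ →L[ℝ] ℝ), ∀ v, ∑ j, f j v = α + L v := by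
    intro f hf
    choose α L hL using hf
    exact ⟨∑ j, α j, ∑ j, L j, fun v => by simp [hL, Finset.sum_add_distrib]⟩
  refine hsum _ fun j => hsum _ fun k => ?_
  set c := inner ℝ (a j) (a k)
  by_cases hjk : j = k
  · subst hjk
    by_cases hj : j = i
    · subst hj
      exact ⟨0, c • ContinuousLinearMap.snd ℝ ℝ ℝ, fun v => by simp⟩
    · exact ⟨c * (z j).2, 0, fun v => by simp [hj]⟩
  · by_cases hj : j = i
    · subst hj
      exact ⟨0, (c * (z k).1) • ContinuousLinearMap.fst ℝ ℝ ℝ, fun v => by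
        simp [hjk, Function.update_of_ne (Ne.symm hjk)]; ring⟩
    · by_cases hk : k = i
      · subst hk
        exact ⟨0, (c * (z j).1) • ContinuousLinearMap.fst ℝ ℝ ℝ, fun v => by
          simp [hjk]; ring⟩
      · exact ⟨c * ((z j).1 * (z k).1), 0, fun v => by simp [hjk, hj, hk]⟩

lemma measurable_iSup_chaosForm {ι : Type*} (S : Set ι) (a : ι → Fin n → H) (p : ℝ) :
    Measurable fun z => (⨆ i ∈ S, ENNReal.ofReal |chaosForm (a i) z|) ^ p :=
  ((lowerSemicontinuous_iSup_ofReal_abs S fun i => continuous_chaosForm (a i)).measurable).pow_const p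

lemma integrable_sq_of_exp {Ω : Type*} [MeasurableSpace Ω] {P : Measure Ω} {X : Ω → ℝ}
    (hX : Measurable X) (h : ∫⁻ ω, ENNReal.ofReal (Real.exp (X ω ^ 2)) ∂P ≤ 2) :
    MemLp X 2 P := by
  rw [memLp_two_iff_integrable_sq hX.aestronglyMeasurable]
  refine ⟨(hX.pow_const 2).aestronglyMeasurable, ?_⟩
  rw [hasFiniteIntegral_iff_ofReal (ae_of_all _ fun _ => sq_nonneg _)]
  refine lt_of_le_of_lt (lintegral_mono fun ω => ENNReal.ofReal_le_ofReal ?_)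
    (h.trans_lt (by norm_num))
  have := Real.add_one_le_exp (X ω ^ 2)
  linarith

lemma integral_norm_act_sq {Ω : Type*} [MeasurableSpace Ω] {P : Measure Ω}
    [IsProbabilityMeasure P] {ξ : Fin n → Ω → ℝ} (hind : iIndepFun ξ P)
    (hmean : ∀ i, ∫ ω, ξ i ω ∂P = 0) (hL2 : ∀ i, MemLp (ξ i) 2 P) (a : Fin n → H) :
    ∫ ω, ‖act a fun j => ξ j ω‖ ^ 2 ∂P = ∑ j, (∫ ω, ξ j ω ^ 2 ∂P) * ‖a j‖ ^ 2 := by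
  simp_rw [norm_act_sq]
  have hI : ∀ j k, Integrable (fun ω => ξ j ω * ξ k ω) P := fun j k => (hL2 j).integrable_mul (hL2 k)
  rw [integral_finsetSum _ fun j _ => integrable_finsetSum _ fun k _ => (hI j k).const_mul _]
  refine Finset.sum_congr rfl fun j _ => ?_
  rw [integral_finsetSum _ fun k _ => (hI j k).const_mul _, Finset.sum_eq_single j]
  · rw [integral_const_mul, real_inner_self_eq_norm_sq, mul_comm]
    simp_rw [pow_two]
  · intro k _ hk
    have := (hind.indepFun hk.symm).integral_mul_eq_mul_integral (hL2 j).aestronglyMeasurable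
      (hL2 k).aestronglyMeasurable
    simp only [Pi.mul_apply] at this
    rw [integral_const_mul]
    change _ * (∫ ω, (ξ j * ξ k) ω ∂P) = 0
    simp only [Pi.mul_apply]
    rw [this, hmean, hmean]; simp
  · simp

/-- Replacement of subgaussian variables by Gaussian ones in suprema of quadratic chaoses. -/
lemma lintegral_iSup_le_gaussian {Ω ι : Type*} [MeasurableSpace Ω] {P : Measure Ω}
    [IsProbabilityMeasure P] {ξ : Fin n → Ω → ℝ} (hm : ∀ i, Measurable (ξ i))
    (hind : iIndepFun ξ P) (hmean : ∀ i, ∫ ω, ξ i ω ∂P = 0) {K : ℝ} (hK : 0 < K)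
    (hexp : ∀ i, ∫⁻ ω, ENNReal.ofReal (Real.exp ((ξ i ω / K) ^ 2)) ∂P ≤ 2)
    (S : Set ι) (a : ι → Fin n → H) {p : ℝ} (hp : 1 ≤ p) :
    ∫⁻ ω, (⨆ i ∈ S, ENNReal.ofReal |‖act (a i) fun j => ξ j ω‖ ^ 2 -
        ∫ ω', ‖act (a i) fun j => ξ j ω'‖ ^ 2 ∂P|) ^ p ∂P ≤
      ENNReal.ofReal (625 * K ^ 2) ^ p * ∫⁻ g, (⨆ i ∈ S,
        ENNReal.ofReal |‖act (a i) g‖ ^ 2 - hsSq (a i)|) ^ p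
          ∂(Measure.pi fun _ : Fin n => gaussianReal 0 1) := by
  set η : Fin n → Ω → ℝ := fun i ω => ξ i ω / K with hη
  have hηm : ∀ i, Measurable (η i) := fun i => (hm i).div_const K
  have hηL2 : ∀ i, MemLp (η i) 2 P := fun i => integrable_sq_of_exp (hηm i) (hexp i)
  have hξη : ∀ i ω, ξ i ω = K * η i ω := fun i ω => by rw [hη]; field_simp
  have hξL2 : ∀ i, MemLp (ξ i) 2 P := fun i => by
    have : ξ i = fun ω => K * η i ω := funext (hξη i)
    rw [this]; exact (hηL2 i).const_mul K
  set s : Fin n → ℝ := fun i => ∫ ω, η i ω ^ 2 ∂P with hs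
  have hleft : ∀ i ω, ‖act (a i) fun j => ξ j ω‖ ^ 2 - ∫ ω', ‖act (a i) fun j => ξ j ω'‖ ^ 2 ∂P =
      K ^ 2 * chaosForm (a i) fun j => (η j ω, η j ω ^ 2 - s j) := fun i ω => by
    rw [integral_norm_act_sq hind hmean hξL2, norm_act_sq_sub, ← chaosForm_smul]
    congr 1
    ext j
    · simp [hξη]
    · simp only [hξη, hs, mul_pow, integral_const_mul]; ring
  -- The Gaussian pair is that of `25 g`, so the chaos is homogeneous of degree two with factor `25
  -- ^ 2`.
  have hright : ∀ i g, chaosForm (a i) (fun j => (25 * g j, 625 * (g j ^ 2 - 1))) =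
      625 * (‖act (a i) g‖ ^ 2 - hsSq (a i)) := fun i g => by
    have h1 := norm_act_sq_sub (a i) g (fun _ => 1)
    have h2 := chaosForm_smul (a i) (fun j => (g j, g j ^ 2 - 1)) 25
    simp only [one_mul] at h1
    rw [hsSq, h1]
    norm_num at h2 ⊢
    exact h2
  have hscale : ∀ (c : ℝ), 0 ≤ c → ∀ f : ι → ℝ, (⨆ i ∈ S, ENNReal.ofReal |c * f i|) ^ p =
      ENNReal.ofReal c ^ p * (⨆ i ∈ S, ENNReal.ofReal |f i|) ^ p := fun c hc f => by
    rw [← ENNReal.mul_rpow_of_nonneg _ _ (by linarith), ENNReal.mul_iSup]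
    congr 2; ext i
    rw [ENNReal.mul_iSup]
    congr 1; ext _
    rw [abs_mul, abs_of_nonneg hc, ENNReal.ofReal_mul hc]
  set F : (Fin n → ℝ × ℝ) → ℝ≥0∞ := fun z => (⨆ i ∈ S, ENNReal.ofReal |chaosForm (a i) z|) ^ p
    with hF
  have hFm : Measurable F := measurable_iSup_chaosForm S a p
  set z : ∀ i, ℝ → ℝ × ℝ := fun i t => (t, t ^ 2 - s i) with hz
  set Z : ℝ → ℝ × ℝ := fun t => (25 * t, 625 * (t ^ 2 - 1)) with hZ
  have hzm : ∀ i, Measurable (z i) := fun i => by fun_prop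
  have hZm : Measurable Z := by fun_prop
  have hzη : ∀ i, Measurable fun ω => z i (η i ω) := fun i => (hzm i).comp (hηm i)
  have hindη : iIndepFun (fun i ω => z i (η i ω)) P :=
    hind.comp (fun i x => z i (x / K)) fun i => (hzm i).comp (measurable_id.div_const K)
  simp_rw [hleft]
  have hK2 : (0 : ℝ) ≤ K ^ 2 := sq_nonneg K
  have e1 : ∀ ω, (⨆ i ∈ S, ENNReal.ofReal |K ^ 2 * chaosForm (a i) fun j =>
      (η j ω, η j ω ^ 2 - s j)|) ^ p = ENNReal.ofReal (K ^ 2) ^ p * F fun j => z j (η j ω) :=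
    fun ω => hscale _ hK2 _
  have e2 : ∀ g : Fin n → ℝ, F (fun j => Z (g j)) = ENNReal.ofReal 625 ^ p *
      (⨆ i ∈ S, ENNReal.ofReal |‖act (a i) g‖ ^ 2 - hsSq (a i)|) ^ p := fun g => by
    rw [← hscale 625 (by norm_num), hF]
    simp only [hZ, hright]
  simp_rw [e1]
  have hzηp : Measurable fun ω => (fun j => z j (η j ω)) := measurable_pi_lambda _ hzη
  have hFz : Measurable fun ω => F fun j => z j (η j ω) := hFm.comp hzηp
  rw [lintegral_const_mul _ hFz, mul_comm (625 : ℝ), ENNReal.ofReal_mul hK2,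
    ENNReal.mul_rpow_of_nonneg _ _ (by linarith), mul_assoc]
  gcongr
  have hprob : ∀ i, IsProbabilityMeasure (P.map fun ω => z i (η i ω)) := fun i =>
    Measure.isProbabilityMeasure_map (hzη i).aemeasurable
  have hprobZ : IsProbabilityMeasure ((gaussianReal 0 1).map Z) :=
    Measure.isProbabilityMeasure_map hZm.aemeasurable
  calc ∫⁻ ω, F (fun j => z j (η j ω)) ∂P
      = ∫⁻ x, F x ∂(Measure.pi fun i => P.map fun ω => z i (η i ω)) := by
        rw [← hindη.map_fun_eq_pi_map fun i => (hzη i).aemeasurable, lintegral_map hFm hzηp]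
    _ ≤ ∫⁻ x, F x ∂(Measure.pi fun _ => (gaussianReal 0 1).map Z) := by
        refine lintegral_pi_le_of_update hFm fun i x => ?_
        have hup : Measurable fun t => F (Function.update x i t) :=
          hFm.comp (measurable_update x)
        rw [lintegral_map hup (hzη i), lintegral_map hup hZm]
        -- With all other coordinates frozen, the functional is the power of a supremum of absolute
        -- values of affine functions, so the one-dimensional comparison applies to coordinate `i`.
        choose α L hL using fun k => chaosForm_update (a k) x i
        have hJ : IsJensen fun t => F (Function.update x i t) := by
          simp only [hF, hL]
          exact isJensen_iSup_affine S α L hp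
        have hprobη : IsProbabilityMeasure (P.map (η i)) :=
          Measure.isProbabilityMeasure_map (hηm i).aemeasurable
        have h1 := lintegral_le_gaussian (ν := P.map (η i))
          (by rw [lintegral_map (by fun_prop) (hηm i)]; exact hexp i)
          (by
            rw [integral_map (hηm i).aemeasurable (by fun_prop), hη]
            simp only
            rw [integral_div, hmean]; simp) hJ hup
        rw [integral_map (hηm i).aemeasurable (by fun_prop)] at h1
        have hupz : Measurable fun t => F (Function.update x i (z i t)) := hup.comp (hzm i)
        have h2 := lintegral_map (μ := P) hupz (hηm i)
        exact h2.symm.trans_le h1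
    _ = ∫⁻ g, F (fun j => Z (g j)) ∂(Measure.pi fun _ => gaussianReal 0 1) := by
        have hZp : Measurable fun (x : Fin n → ℝ) i => Z (x i) :=
          measurable_pi_lambda _ fun j => hZm.comp (measurable_pi_apply j)
        rw [← Measure.pi_map_pi fun _ => hZm.aemeasurable, lintegral_map hFm hZp]
    _ = _ := by
        simp_rw [e2]
        rw [lintegral_const_mul']
        exact (ENNReal.rpow_lt_top_of_nonneg (by linarith) ENNReal.ofReal_ne_top).ne

end Chaos
end

/-! ### Gaussian measures: decoupling and moments of linear forms -/

noncomputable section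

namespace Chaos

/-- The `L^p` seminorm of an extended nonnegative function. -/
def lpN {X : Type*} [MeasurableSpace X] (p : ℝ) (ρ : Measure X) (f : X → ℝ≥0∞) : ℝ≥0∞ :=
  (∫⁻ x, f x ^ p ∂ρ) ^ (1 / p)

section LpN

variable {X : Type*} [MeasurableSpace X] {ρ : Measure X} {p : ℝ} {f g : X → ℝ≥0∞}

lemma lpN_mono (hp : 1 ≤ p) (h : ∀ x, f x ≤ g x) : lpN p ρ f ≤ lpN p ρ g := by
  unfold lpN
  have h1 : (0 : ℝ) ≤ 1 / p := by positivity
  have h2 : (0 : ℝ) ≤ p := by linarith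
  gcongr with x
  exact h x

lemma lpN_add_le (hp : 1 ≤ p) (hf : AEMeasurable f ρ) (hg : AEMeasurable g ρ) :
    lpN p ρ (fun x => f x + g x) ≤ lpN p ρ f + lpN p ρ g :=
  ENNReal.lintegral_Lp_add_le hf hg hp

lemma lpN_rpow (hp : 1 ≤ p) : lpN p ρ f ^ p = ∫⁻ x, f x ^ p ∂ρ := by
  rw [lpN, ← ENNReal.rpow_mul, one_div_mul_cancel (by positivity), ENNReal.rpow_one]

lemma lpN_le_iff (hp : 1 ≤ p) {c : ℝ≥0∞} : lpN p ρ f ≤ c ↔ ∫⁻ x, f x ^ p ∂ρ ≤ c ^ p := by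
  rw [← lpN_rpow hp, ENNReal.rpow_le_rpow_iff (by linarith)]

lemma lpN_const [IsProbabilityMeasure ρ] (hp : 1 ≤ p) (c : ℝ≥0∞) : lpN p ρ (fun _ => c) = c := by
  rw [lpN, lintegral_const, measure_univ, mul_one, ← ENNReal.rpow_mul,
    mul_one_div_cancel (by positivity), ENNReal.rpow_one]

lemma lpN_const_mul (hp : 1 ≤ p) (c : ℝ≥0∞) (hf : Measurable f) :
    lpN p ρ (fun x => c * f x) = c * lpN p ρ f := by
  have h2 : (0 : ℝ) ≤ p := by linarith
  unfold lpN
  simp_rw [ENNReal.mul_rpow_of_nonneg _ _ h2]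
  rw [lintegral_const_mul _ (hf.pow_const p), ENNReal.mul_rpow_of_nonneg _ _ (by positivity),
    ← ENNReal.rpow_mul, mul_one_div_cancel (by positivity), ENNReal.rpow_one]

lemma lpN_le_lpN [IsProbabilityMeasure ρ] {q : ℝ} (hp : 1 ≤ p) (hpq : p ≤ q)
    (hf : AEMeasurable f ρ) : lpN p ρ f ≤ lpN q ρ f := by
  have h := eLpNorm'_le_eLpNorm'_of_exponent_le (f := f) (by linarith) hpq ρ
    hf.aestronglyMeasurable
  simpa only [eLpNorm', enorm_eq_self, lpN] using h

lemma lpN_sq (hp : 1 ≤ p) : lpN p ρ (fun x => f x ^ 2) = lpN (2 * p) ρ f ^ 2 := by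
  unfold lpN
  have : ∀ x, (f x ^ 2) ^ p = f x ^ (2 * p) := fun x => by
    rw [ENNReal.rpow_mul]; norm_num
  simp_rw [this]
  rw [← ENNReal.rpow_natCast, ← ENNReal.rpow_mul]
  congr 1
  field_simp; norm_num

end LpN

/-- The standard Gaussian measure on `ℝ ^ n`. -/
abbrev stdGauss (n : ℕ) : Measure (Fin n → ℝ) := Measure.pi fun _ => gaussianReal 0 1

/-- Gaussianity of the measure on the whole space supplies rotation invariance for decoupling and
the finiteness of all moments of the norm. -/
instance isGaussian_stdGauss (n : ℕ) : IsGaussian (stdGauss n) := by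
  have h := iIndepFun.hasGaussianLaw (P := stdGauss n) (X := fun i (x : Fin n → ℝ) => x i)
    (fun i => ⟨by
      rw [(measurePreserving_eval (fun _ : Fin n => gaussianReal 0 1) i).map_eq]
      infer_instance⟩)
    (iIndepFun_pi (μ := fun _ : Fin n => gaussianReal 0 1) (X := fun _ x => x)
      fun _ => aemeasurable_id)
  have := h.isGaussian_map
  simpa using this

lemma integral_eval_stdGauss {n : ℕ} (i : Fin n) : ∫ x, x i ∂(stdGauss n) = 0 := by
  have h := measurePreserving_eval (fun _ : Fin n => gaussianReal 0 1) i
  have h2 := integral_map (μ := stdGauss n) (φ := Function.eval i) (f := fun x : ℝ => x)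
    h.measurable.aemeasurable (by fun_prop)
  rw [h.map_eq, integral_id_gaussianReal] at h2
  exact h2.symm

lemma memLp_eval_stdGauss {n : ℕ} (i : Fin n) : MemLp (fun x => x i) 2 (stdGauss n) := by
  have h := measurePreserving_eval (fun _ : Fin n => gaussianReal 0 1) i
  exact (memLp_id_gaussianReal (μ := 0) (v := 1) 2).comp_measurePreserving h

lemma integral_eval_sq_stdGauss {n : ℕ} (i : Fin n) : ∫ x, x i ^ 2 ∂(stdGauss n) = 1 := by
  have h := measurePreserving_eval (fun _ : Fin n => gaussianReal 0 1) i
  have h2 := integral_map (μ := stdGauss n) (φ := Function.eval i) (f := fun x : ℝ => x ^ 2)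
    h.measurable.aemeasurable (by fun_prop)
  rw [h.map_eq, integral_sq_gaussian] at h2
  simpa using h2.symm

lemma integral_id_stdGauss (n : ℕ) : (stdGauss n)[id] = 0 := by
  ext i
  simp only [id]
  rw [eval_integral (fun i => (memLp_eval_stdGauss i).integrable (by norm_num))]
  exact integral_eval_stdGauss i

lemma iIndepFun_eval_stdGauss (n : ℕ) :
    iIndepFun (fun i (x : Fin n → ℝ) => x i) (stdGauss n) :=
  iIndepFun_pi (μ := fun _ : Fin n => gaussianReal 0 1) (X := fun _ x => x) fun _ => aemeasurable_id

variable {H : Type*} [NormedAddCommGroup H] [InnerProductSpace ℝ H] {n : ℕ}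

lemma integral_norm_act_sq_stdGauss (a : Fin n → H) :
    ∫ x, ‖act a x‖ ^ 2 ∂(stdGauss n) = hsSq a := by
  have := integral_norm_act_sq (iIndepFun_eval_stdGauss n) integral_eval_stdGauss
    memLp_eval_stdGauss a
  simpa only [integral_eval_sq_stdGauss, one_mul, hsSq] using this

lemma continuous_act (a : Fin n → H) : Continuous (act a) := by
  unfold act; fun_prop

lemma act_add_right (a : Fin n → H) (x y : Fin n → ℝ) : act a (x + y) = act a x + act a y := by
  simp [act, add_smul, Finset.sum_add_distrib]

lemma act_smul_right (a : Fin n → H) (c : ℝ) (x : Fin n → ℝ) : act a (c • x) = c • act a x := by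
  simp [act, Finset.smul_sum, smul_smul]

lemma act_sub_left (a b : Fin n → H) (x : Fin n → ℝ) : act (a - b) x = act a x - act b x := by
  simp [act, smul_sub, Finset.sum_sub_distrib]

lemma inner_act_left (a : Fin n → H) (x : Fin n → ℝ) (v : H) :
    inner ℝ (act a x) v = ∑ j, x j * inner ℝ (a j) v := by
  simp [act, sum_inner, real_inner_smul_left]

lemma integrable_norm_act_sq (a : Fin n → H) : Integrable (fun x => ‖act a x‖ ^ 2) (stdGauss n) := by
  simp_rw [norm_act_sq]
  exact integrable_finsetSum _ fun j _ => integrable_finsetSum _ fun k _ =>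
    ((memLp_eval_stdGauss j).integrable_mul (memLp_eval_stdGauss k)).const_mul _

lemma measurable_iSup_bilin {ι : Type*} (S : Set ι) (a b : ι → Fin n → H) :
    Measurable fun q : (Fin n → ℝ) × (Fin n → ℝ) =>
      ⨆ i ∈ S, ENNReal.ofReal |inner ℝ (act (a i) q.1) (act (b i) q.2)| :=
  (lowerSemicontinuous_iSup_ofReal_abs S
    (f := fun i (q : (Fin n → ℝ) × (Fin n → ℝ)) => inner ℝ (act (a i) q.1) (act (b i) q.2))
    fun i => ((continuous_act (a i)).comp continuous_fst).inner
      ((continuous_act (b i)).comp continuous_snd)).measurable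

lemma measurable_iSup_dev {ι : Type*} (S : Set ι) (a : ι → Fin n → H) :
    Measurable fun x => ⨆ i ∈ S, ENNReal.ofReal |‖act (a i) x‖ ^ 2 - hsSq (a i)| :=
  (lowerSemicontinuous_iSup_ofReal_abs S (f := fun i x => ‖act (a i) x‖ ^ 2 - hsSq (a i))
    fun i => ((continuous_act (a i)).norm.pow 2).sub continuous_const).measurable

/-- Gaussian decoupling by symmetrization and rotation invariance. -/
lemma lpN_dev_le_bilin {ι : Type*} (S : Set ι) (a : ι → Fin n → H) {p : ℝ} (hp : 1 ≤ p) :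
    lpN p (stdGauss n) (fun x => ⨆ i ∈ S, ENNReal.ofReal |‖act (a i) x‖ ^ 2 - hsSq (a i)|) ≤
      2 * lpN p ((stdGauss n).prod (stdGauss n)) (fun q =>
        ⨆ i ∈ S, ENNReal.ofReal |inner ℝ (act (a i) q.1) (act (a i) q.2)|) := by
  have hp0 : 0 ≤ p := by linarith
  set μ := stdGauss n
  set G : (Fin n → ℝ) × (Fin n → ℝ) → ℝ≥0∞ := fun q =>
    ⨆ i ∈ S, ENNReal.ofReal |‖act (a i) q.1‖ ^ 2 - ‖act (a i) q.2‖ ^ 2| with hG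
  have hGm : Measurable G := (lowerSemicontinuous_iSup_ofReal_abs S
    (f := fun i (q : (Fin n → ℝ) × (Fin n → ℝ)) => ‖act (a i) q.1‖ ^ 2 - ‖act (a i) q.2‖ ^ 2)
    fun i => (((continuous_act (a i)).comp continuous_fst).norm.pow 2).sub
      (((continuous_act (a i)).comp continuous_snd).norm.pow 2)).measurable
  have hBm := measurable_iSup_bilin S a a
  rw [← lpN_const_mul hp _ hBm, lpN_le_iff hp, lpN_rpow hp]
  -- Symmetrization: `hsSq` is the mean of an independent copy, which Jensen's inequality moves
  -- outside the supremum and the power.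
  have h1 : ∀ x, (⨆ i ∈ S, ENNReal.ofReal |‖act (a i) x‖ ^ 2 - hsSq (a i)|) ^ p ≤
      ∫⁻ y, G (x, y) ^ p ∂μ := fun x => by
    have hGx : Measurable fun y => G (x, y) := hGm.comp measurable_prodMk_left
    refine le_trans ?_ (rpow_lintegral_le hGx.aemeasurable hp)
    refine ENNReal.rpow_le_rpow (iSup₂_le fun i hi => ?_) hp0
    have hI : Integrable (fun y => ‖act (a i) x‖ ^ 2 - ‖act (a i) y‖ ^ 2) μ :=
      (integrable_const _).sub (integrable_norm_act_sq (a i))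
    have e1 : ‖act (a i) x‖ ^ 2 - hsSq (a i) = ∫ y, (‖act (a i) x‖ ^ 2 - ‖act (a i) y‖ ^ 2) ∂μ := by
      rw [integral_sub (integrable_const _) (integrable_norm_act_sq (a i)),
        integral_norm_act_sq_stdGauss]
      simp
    calc ENNReal.ofReal |‖act (a i) x‖ ^ 2 - hsSq (a i)|
        ≤ ENNReal.ofReal (∫ y, |‖act (a i) x‖ ^ 2 - ‖act (a i) y‖ ^ 2| ∂μ) := by
          rw [e1]; exact ENNReal.ofReal_le_ofReal abs_integral_le_integral_abs
      _ = ∫⁻ y, ENNReal.ofReal |‖act (a i) x‖ ^ 2 - ‖act (a i) y‖ ^ 2| ∂μ :=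
          ofReal_integral_eq_lintegral_ofReal hI.abs (ae_of_all _ fun _ => abs_nonneg _)
      _ ≤ ∫⁻ y, G (x, y) ∂μ :=
          lintegral_mono fun y => le_iSup₂ (f := fun i (_ : i ∈ S) =>
            ENNReal.ofReal |‖act (a i) x‖ ^ 2 - ‖act (a i) y‖ ^ 2|) i hi
  set θ : ℝ := Real.pi / 4
  have hrot := IsGaussian.map_rotation_eq_self (integral_id_stdGauss n) θ
  set B : (Fin n → ℝ) × (Fin n → ℝ) → ℝ≥0∞ := fun q =>
    ⨆ i ∈ S, ENNReal.ofReal |inner ℝ (act (a i) q.1) (act (a i) q.2)| with hB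
  -- For `θ = π / 4` the rotated vectors are `(x + y) / √2` and `(y - x) / √2`, and `2 ⟨A u, A v⟩`
  -- becomes `‖A y‖ ^ 2 - ‖A x‖ ^ 2`.
  have hGB : ∀ q, 2 * B (ContinuousLinearMap.rotation θ q) = G q := fun q => by
    simp only [hB, hG, ENNReal.mul_iSup]
    congr 1; ext i; congr 1; ext _
    rw [← ENNReal.ofReal_ofNat 2, ← ENNReal.ofReal_mul (by norm_num)]
    congr 1
    have h2abs : ∀ r : ℝ, 2 * |r| = |2 * r| := fun r => by rw [abs_mul, abs_two]
    rw [h2abs, abs_sub_comm]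
    congr 1
    rw [ContinuousLinearMap.rotation_apply]
    simp only [act_add_right, act_smul_right, Real.cos_pi_div_four, Real.sin_pi_div_four, θ]
    simp only [inner_add_left, inner_add_right, real_inner_smul_left, real_inner_smul_right]
    simp only [real_inner_self_eq_norm_sq]
    rw [real_inner_comm (act (a i) q.2) (act (a i) q.1)]
    have h2 : √2 * √2 = 2 := Real.mul_self_sqrt (by norm_num)
    linear_combination (1 / 2 * (‖act (a i) q.2‖ ^ 2 - ‖act (a i) q.1‖ ^ 2)) * h2
  have hBp : Measurable fun q => (2 * B q) ^ p := (hBm.const_mul 2).pow_const p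
  calc _ ≤ ∫⁻ x, ∫⁻ y, G (x, y) ^ p ∂μ ∂μ := lintegral_mono h1
    _ = ∫⁻ q, G q ^ p ∂(μ.prod μ) := (lintegral_prod _ (hGm.pow_const p).aemeasurable).symm
    _ = ∫⁻ q, (2 * B (ContinuousLinearMap.rotation θ q)) ^ p ∂(μ.prod μ) := by simp_rw [hGB]
    _ = ∫⁻ q, (2 * B q) ^ p ∂((μ.prod μ).map (ContinuousLinearMap.rotation θ)) :=
        (lintegral_map hBp (ContinuousLinearMap.continuous _).measurable).symm
    _ = _ := by rw [hrot]

/-- Moments of linear forms of a standard Gaussian vector. -/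
lemma lpN_sum_mul_le (b : Fin n → ℝ) {s : ℝ} (hs : 0 ≤ s) (hb : ∑ j, b j ^ 2 ≤ s ^ 2) {p : ℝ}
    (hp : 1 ≤ p) :
    lpN p (stdGauss n) (fun x => ENNReal.ofReal |∑ j, x j * b j|) ≤
      ENNReal.ofReal (4 * √p * s) := by
  have hp0 : 0 < p := by linarith
  rcases hs.eq_or_lt with rfl | hs
  · have hb0 : ∀ j, b j = 0 := fun j => by
      have h := Finset.single_le_sum (f := fun j => b j ^ 2) (fun j _ => sq_nonneg (b j))
        (Finset.mem_univ j)
      have : b j ^ 2 ≤ 0 := by simpa using h.trans hb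
      exact pow_eq_zero_iff (two_ne_zero) |>.1 (le_antisymm this (sq_nonneg _))
    simp [hb0, lpN_const hp]
  -- The Chernoff parameter for which the Laplace transform is at most `exp (p / 2)` while `p / l =
  -- √p * s`.
  set l : ℝ := √p / s with hl
  have hl0 : 0 < l := by positivity
  have hexp : ∀ c : ℝ, c ^ 2 = l ^ 2 → ∫⁻ x, ENNReal.ofReal (Real.exp (c * ∑ j, x j * b j))
      ∂(stdGauss n) ≤ ENNReal.ofReal (Real.exp (p / 2)) := fun c hc => by
    have e1 : ∀ x : Fin n → ℝ, ENNReal.ofReal (Real.exp (c * ∑ j, x j * b j)) =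
        ∏ j, ENNReal.ofReal (Real.exp ((c * b j) * x j)) := fun x => by
      rw [← ENNReal.ofReal_prod_of_nonneg fun _ _ => (Real.exp_pos _).le, ← Real.exp_sum,
        Finset.mul_sum]
      congr 2
      exact Finset.sum_congr rfl fun j _ => by ring
    have e2 : ∀ j : Fin n, ∫⁻ x, ENNReal.ofReal (Real.exp ((c * b j) * x j)) ∂(stdGauss n) =
        ENNReal.ofReal (Real.exp ((c * b j) ^ 2 / 2)) := fun j => by
      have h := measurePreserving_eval (fun _ : Fin n => gaussianReal 0 1) j
      have hm : Measurable fun t : ℝ => ENNReal.ofReal (Real.exp ((c * b j) * t)) := by fun_prop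
      have h2 := h.lintegral_comp hm
      rw [show (∫⁻ x, ENNReal.ofReal (Real.exp ((c * b j) * x j)) ∂(stdGauss n)) =
        ∫⁻ t, ENNReal.ofReal (Real.exp ((c * b j) * t)) ∂(gaussianReal 0 1) from h2,
        ← ofReal_integral_eq_lintegral_ofReal (integrable_exp_mul_gaussianReal _)
          (ae_of_all _ fun _ => (Real.exp_pos _).le)]
      have h3 := congrFun (mgf_fun_id_gaussianReal (μ := 0) (v := 1)) (c * b j)
      rw [mgf] at h3
      rw [h3]
      simp
    simp_rw [e1]
    rw [lintegral_prod_eq_prod_lintegral_of_indepFun Finset.univ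
      (fun j (x : Fin n → ℝ) => ENNReal.ofReal (Real.exp ((c * b j) * x j)))
      ((iIndepFun_eval_stdGauss n).comp (fun j t => ENNReal.ofReal (Real.exp ((c * b j) * t)))
        fun j => by fun_prop) fun j => by fun_prop]
    simp_rw [e2]
    rw [← ENNReal.ofReal_prod_of_nonneg fun _ _ => (Real.exp_pos _).le, ← Real.exp_sum]
    refine ENNReal.ofReal_le_ofReal (Real.exp_le_exp.2 ?_)
    have : ∑ j, (c * b j) ^ 2 / 2 = l ^ 2 / 2 * ∑ j, b j ^ 2 := by
      rw [Finset.mul_sum]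
      exact Finset.sum_congr rfl fun j _ => by rw [mul_pow, hc]; ring
    rw [this]
    calc l ^ 2 / 2 * ∑ j, b j ^ 2 ≤ l ^ 2 / 2 * s ^ 2 := by gcongr
      _ = p / 2 := by rw [hl, div_pow, Real.sq_sqrt hp0.le]; field_simp
  rw [lpN_le_iff hp]
  have hpt : ∀ y : ℝ, ENNReal.ofReal |y| ^ p ≤ ENNReal.ofReal ((p / l) ^ p) *
      (ENNReal.ofReal (Real.exp (l * y)) + ENNReal.ofReal (Real.exp (-l * y))) := fun y => by
    rw [ENNReal.ofReal_rpow_of_nonneg (abs_nonneg y) hp0.le,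
      ← ENNReal.ofReal_add (Real.exp_pos _).le (Real.exp_pos _).le,
      ← ENNReal.ofReal_mul (by positivity)]
    refine ENNReal.ofReal_le_ofReal ?_
    have h1 : |y| ≤ (p / l) * Real.exp (l * |y| / p) := by
      have := Real.add_one_le_exp (l * |y| / p)
      calc |y| = (p / l) * (l * |y| / p) := by field_simp
        _ ≤ _ := by gcongr; linarith
    have h2 : Real.exp (l * |y|) ≤ Real.exp (l * y) + Real.exp (-l * y) := by
      rcases abs_cases y with ⟨h, _⟩ | ⟨h, _⟩ <;> rw [h]
      · linarith [Real.exp_pos (-l * y)]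
      · rw [mul_neg, ← neg_mul]; linarith [Real.exp_pos (l * y)]
    calc |y| ^ p ≤ ((p / l) * Real.exp (l * |y| / p)) ^ p := by gcongr
      _ = (p / l) ^ p * Real.exp (l * |y|) := by
          rw [Real.mul_rpow (by positivity) (Real.exp_pos _).le, ← Real.exp_mul]
          congr 2; field_simp
      _ ≤ _ := by gcongr
  calc ∫⁻ x, ENNReal.ofReal |∑ j, x j * b j| ^ p ∂(stdGauss n)
      ≤ ∫⁻ x, ENNReal.ofReal ((p / l) ^ p) * (ENNReal.ofReal (Real.exp (l * ∑ j, x j * b j)) +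
          ENNReal.ofReal (Real.exp (-l * ∑ j, x j * b j))) ∂(stdGauss n) :=
        lintegral_mono fun x => hpt _
    _ = ENNReal.ofReal ((p / l) ^ p) *
        (∫⁻ x, ENNReal.ofReal (Real.exp (l * ∑ j, x j * b j)) ∂(stdGauss n) +
          ∫⁻ x, ENNReal.ofReal (Real.exp (-l * ∑ j, x j * b j)) ∂(stdGauss n)) := by
        rw [lintegral_const_mul _ (by fun_prop), lintegral_add_left (by fun_prop)]
    _ ≤ ENNReal.ofReal ((p / l) ^ p) *
        (ENNReal.ofReal (Real.exp (p / 2)) + ENNReal.ofReal (Real.exp (p / 2))) := by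
        gcongr
        · exact hexp l rfl
        · exact hexp (-l) (by ring)
    _ ≤ ENNReal.ofReal (4 * √p * s) ^ p := by
        rw [← ENNReal.ofReal_add (Real.exp_pos _).le (Real.exp_pos _).le,
          ← ENNReal.ofReal_mul (by positivity),
          ENNReal.ofReal_rpow_of_nonneg (by positivity) hp0.le]
        refine ENNReal.ofReal_le_ofReal ?_
        have h1 : p / l = √p * s := by
          rw [hl]; field_simp; rw [Real.sq_sqrt hp0.le]
        -- The two signs contribute `2 * exp (p / 2) ≤ 2 ^ p * 2 ^ p`, whence the constant `4`.
        have h2 : Real.exp (p / 2) ≤ 2 ^ p := by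
          have : Real.exp (1 / 2) ≤ 2 := by
            have h := Real.exp_one_lt_d9
            have h3 : Real.exp (1 / 2) * Real.exp (1 / 2) = Real.exp 1 := by
              rw [← Real.exp_add]; norm_num
            nlinarith [Real.exp_pos (1 / 2)]
          calc Real.exp (p / 2) = Real.exp (1 / 2) ^ p := by
                rw [← Real.exp_mul]; congr 1; ring
            _ ≤ _ := by gcongr
        have h3 : (2 : ℝ) ≤ 2 ^ p := by
          calc (2 : ℝ) = 2 ^ (1 : ℝ) := by norm_num
            _ ≤ _ := Real.rpow_le_rpow_of_exponent_le (by norm_num) hp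
        have h4 : 0 ≤ √p * s := by positivity
        rw [h1, show 4 * √p * s = (2 * 2) * (√p * s) by ring,
          Real.mul_rpow (x := 2 * 2) (by norm_num) h4,
          Real.mul_rpow (x := 2) (y := 2) (by norm_num) (by norm_num), mul_comm]
        gcongr
        calc Real.exp (p / 2) + Real.exp (p / 2) = 2 * Real.exp (p / 2) := by ring
          _ ≤ 2 ^ p * 2 ^ p := by gcongr

end Chaos
end

/-! ### Moments of a Gaussian norm and of a single bilinear form -/

noncomputable section

namespace Chaos

section LpN

variable {X Y : Type*} [MeasurableSpace X] [MeasurableSpace Y] {ρ : Measure X} {ν : Measure Y}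
  [SFinite ρ] [SFinite ν] {p : ℝ}

lemma lpN_prod_le_snd (hp : 1 ≤ p) {F : X × Y → ℝ≥0∞} {G : Y → ℝ≥0∞} (hF : Measurable F)
    (h : ∀ y, lpN p ρ (fun x => F (x, y)) ≤ G y) : lpN p (ρ.prod ν) F ≤ lpN p ν G := by
  rw [lpN_le_iff hp, lpN_rpow hp, lintegral_prod_symm _ (hF.pow_const p).aemeasurable]
  exact lintegral_mono fun y => (lpN_le_iff hp).1 (h y)

lemma lpN_prod_le_fst (hp : 1 ≤ p) {F : X × Y → ℝ≥0∞} {G : X → ℝ≥0∞} (hF : Measurable F)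
    (h : ∀ x, lpN p ν (fun y => F (x, y)) ≤ G x) : lpN p (ρ.prod ν) F ≤ lpN p ρ G := by
  rw [lpN_le_iff hp, lpN_rpow hp, lintegral_prod _ (hF.pow_const p).aemeasurable]
  exact lintegral_mono fun y => (lpN_le_iff hp).1 (h y)

end LpN

variable {H : Type*} [NormedAddCommGroup H] [InnerProductSpace ℝ H] {n : ℕ}

/-- `D` bounds the operator norm of the map with columns `a`. -/
def OpBound (a : Fin n → H) (D : ℝ) : Prop := ∀ x, ‖act a x‖ ≤ D * √(∑ j, x j ^ 2)

/-- The adjoint has the same norm bound. With `X = ‖a* v‖ ^ 2 = ⟨a a* v, v⟩`, Cauchy–Schwarz gives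
`X ≤ D √X ‖v‖`, and one factor `√X` cancels. -/
lemma OpBound.sum_inner_sq_le {a : Fin n → H} {D : ℝ} (h : OpBound a D) (hD : 0 ≤ D) (v : H) :
    ∑ j, inner ℝ (a j) v ^ 2 ≤ (D * ‖v‖) ^ 2 := by
  set X := ∑ j, inner ℝ (a j) v ^ 2 with hX
  have hX0 : 0 ≤ X := Finset.sum_nonneg fun _ _ => sq_nonneg _
  have h1 : X = inner ℝ (act a fun j => inner ℝ (a j) v) v := by
    rw [inner_act_left, hX]
    exact Finset.sum_congr rfl fun j _ => by ring
  have h2 : √X * √X ≤ (D * ‖v‖) * √X := by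
    rw [Real.mul_self_sqrt hX0]
    calc X ≤ ‖act a fun j => inner ℝ (a j) v‖ * ‖v‖ := by
          conv_lhs => rw [h1]
          exact real_inner_le_norm _ _
      _ ≤ (D * √X) * ‖v‖ := by gcongr; exact h _
      _ = _ := by ring
  rcases (Real.sqrt_nonneg X).eq_or_lt with h0 | h0
  · have : X = 0 := (Real.sqrt_eq_zero hX0).1 h0.symm
    rw [this]; positivity
  · have h3 := le_of_mul_le_mul_right h2 h0
    calc X = √X ^ 2 := (Real.sq_sqrt hX0).symm
      _ ≤ _ := by gcongr

lemma OpBound.lpN_inner_le {a : Fin n → H} {D : ℝ} (h : OpBound a D) (hD : 0 ≤ D) (v : H)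
    {p : ℝ} (hp : 1 ≤ p) :
    lpN p (stdGauss n) (fun x => ENNReal.ofReal |inner ℝ (act a x) v|) ≤
      ENNReal.ofReal (4 * √p * (D * ‖v‖)) := by
  simp_rw [inner_act_left]
  exact lpN_sum_mul_le _ (by positivity) (h.sum_inner_sq_le hD v) hp

lemma measurable_iSup_norm_act {ι : Type*} (S : Set ι) (a : ι → Fin n → H) :
    Measurable fun x => ⨆ i ∈ S, ENNReal.ofReal ‖act (a i) x‖ := by
  have := lowerSemicontinuous_iSup_ofReal_abs S (f := fun i x => ‖act (a i) x‖)
    fun i => (continuous_act (a i)).norm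
  simpa using this.measurable

/-- A crude dimension-dependent bound, needed only for finiteness: the self-bounding inequalities
below are vacuous for an infinite moment. -/
lemma lpN_iSup_norm_act_lt_top {ι : Type*} (S : Set ι) (a : ι → Fin n → H) {D : ℝ} (hD : 0 ≤ D)
    (h : ∀ i ∈ S, OpBound (a i) D) {p : ℝ} (hp : 1 ≤ p) :
    lpN p (stdGauss n) (fun x => ⨆ i ∈ S, ENNReal.ofReal ‖act (a i) x‖) < ∞ := by
  have h1 : ∀ x : Fin n → ℝ, (⨆ i ∈ S, ENNReal.ofReal ‖act (a i) x‖) ≤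
      ENNReal.ofReal (D * √n) * ‖x‖ₑ := fun x => iSup₂_le fun i hi => by
    rw [← ofReal_norm, ← ENNReal.ofReal_mul (by positivity)]
    refine ENNReal.ofReal_le_ofReal ((h i hi x).trans ?_)
    rw [mul_assoc]
    gcongr
    rw [Real.sqrt_le_left (by positivity), mul_pow, Real.sq_sqrt (by positivity)]
    calc ∑ j, x j ^ 2 ≤ ∑ j : Fin n, ‖x‖ ^ 2 := Finset.sum_le_sum fun j _ => by
          have := norm_le_pi_norm x j
          rw [← sq_abs]
          gcongr
          exact this
      _ = _ := by simp
  refine (lpN_mono hp h1).trans_lt ?_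
  rw [lpN_const_mul hp _ measurable_enorm]
  refine ENNReal.mul_lt_top ENNReal.ofReal_lt_top ?_
  have hm := IsGaussian.memLp_id (stdGauss n) (ENNReal.ofReal p) ENNReal.ofReal_ne_top
  have h2 := hm.2
  rw [eLpNorm_eq_lintegral_rpow_enorm_toReal (by simpa using by linarith) ENNReal.ofReal_ne_top,
    ENNReal.toReal_ofReal (by linarith)] at h2
  exact h2

lemma le_sqrt_add_of_sq_le {y h β : ℝ} (hh : 0 ≤ h) (hβ : 0 ≤ β) (H : y ^ 2 ≤ h + β * y) :
    y ≤ √h + β := by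
  by_contra! hc
  have hs := Real.sqrt_nonneg h
  have h2 := Real.sq_sqrt hh
  nlinarith

/-- Moments of the norm of a Gaussian vector. -/
lemma lpN_norm_act_le {b : Fin n → H} {D : ℝ} (h : OpBound b D) (hD : 0 ≤ D) {p : ℝ}
    (hp : 1 ≤ p) :
    lpN p (stdGauss n) (fun x => ENNReal.ofReal ‖act b x‖) ≤
      ENNReal.ofReal (√(hsSq b) + 8 * √p * D) := by
  set μ := stdGauss n
  set f : (Fin n → ℝ) → ℝ≥0∞ := fun x => ENNReal.ofReal ‖act b x‖ with hf
  have hfm : Measurable f := (continuous_act b).norm.measurable.ennreal_ofReal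
  have h2p : (1 : ℝ) ≤ 2 * p := by linarith
  have hfin : lpN (2 * p) μ f < ∞ := by
    have := lpN_iSup_norm_act_lt_top (Set.univ : Set Unit) (fun _ => b) hD (fun _ _ => h) h2p
    simpa only [Set.mem_univ, iSup_pos, ciSup_const] using this
  have hhs : 0 ≤ hsSq b := Finset.sum_nonneg fun _ _ => sq_nonneg _
  set dv : (Fin n → ℝ) → ℝ≥0∞ := fun x => ENNReal.ofReal |‖act b x‖ ^ 2 - hsSq b| with hdv
  have hdvm : Measurable dv :=
    (((continuous_act b).norm.pow 2).sub continuous_const).abs.measurable.ennreal_ofReal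
  have hdev : lpN p μ dv ≤ 2 * (ENNReal.ofReal (4 * √p * D) * lpN p μ f) := by
    have h1 := lpN_dev_le_bilin (Set.univ : Set Unit) (fun _ => b) hp
    simp only [Set.mem_univ, iSup_pos, ciSup_const] at h1
    refine h1.trans ?_
    gcongr
    rw [← lpN_const_mul hp _ hfm]
    refine lpN_prod_le_snd hp ?_ fun y => ?_
    · have := measurable_iSup_bilin (Set.univ : Set Unit) (fun _ => b) (fun _ => b)
      simpa using this
    · refine (h.lpN_inner_le hD (act b y) hp).trans_eq ?_
      rw [← mul_assoc, ENNReal.ofReal_mul (by positivity)]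
  -- Self-bounding: after decoupling, the deviation of `‖b g‖ ^ 2` is controlled by the moment of
  -- `‖b g‖` itself. The exponent `2 p` appears because the `p`-norm of a square is the squared `2
  -- p`-norm.
  have hsq : lpN (2 * p) μ f ^ 2 ≤ ENNReal.ofReal (hsSq b) +
      2 * (ENNReal.ofReal (4 * √p * D) * lpN (2 * p) μ f) := by
    rw [← lpN_sq hp]
    calc lpN p μ (fun x => f x ^ 2) ≤ lpN p μ (fun x => ENNReal.ofReal (hsSq b) + dv x) := by
          refine lpN_mono hp fun x => ?_
          rw [hf, hdv]
          simp only
          rw [← ENNReal.ofReal_pow (norm_nonneg _), ← ENNReal.ofReal_add hhs (abs_nonneg _)]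
          refine ENNReal.ofReal_le_ofReal ?_
          have := le_abs_self (‖act b x‖ ^ 2 - hsSq b)
          linarith
      _ ≤ _ := lpN_add_le hp aemeasurable_const hdvm.aemeasurable
      _ ≤ _ := by
          rw [lpN_const hp]
          gcongr
          refine hdev.trans ?_
          gcongr
          exact lpN_le_lpN hp (by linarith) hfm.aemeasurable
  refine (lpN_le_lpN hp (by linarith : p ≤ 2 * p) hfm.aemeasurable).trans ?_
  set y := (lpN (2 * p) μ f).toReal with hy
  have hy' : lpN (2 * p) μ f = ENNReal.ofReal y := (ENNReal.ofReal_toReal hfin.ne).symm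
  have hy0 : 0 ≤ y := ENNReal.toReal_nonneg
  rw [hy'] at hsq ⊢
  rw [← ENNReal.ofReal_pow hy0, ← ENNReal.ofReal_mul (by positivity), ← ENNReal.ofReal_ofNat 2,
    ← ENNReal.ofReal_mul (by norm_num), ← ENNReal.ofReal_add hhs (by positivity),
    ENNReal.ofReal_le_ofReal_iff (by positivity)] at hsq
  refine ENNReal.ofReal_le_ofReal (le_sqrt_add_of_sq_le hhs (by positivity) ?_)
  linarith

/-- Moments of a decoupled Gaussian quadratic form. -/
lemma lpN_bilin_le {a : Fin n → H} {D : ℝ} (h : OpBound a D) (hD : 0 ≤ D) {p : ℝ}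
    (hp : 1 ≤ p) :
    lpN p ((stdGauss n).prod (stdGauss n))
        (fun q => ENNReal.ofReal |inner ℝ (act a q.1) (act a q.2)|) ≤
      ENNReal.ofReal (4 * √p * √(∑ j, ∑ k, inner ℝ (a j) (a k) ^ 2) + 32 * p * D ^ 2) := by
  -- The columns of the Gram matrix. For frozen `y` the form is linear in `x` with coefficient
  -- vector `act b y`, so its moment reduces to that of a Gaussian norm, with operator bound `D ^
  -- 2`.
  set b : Fin n → EuclideanSpace ℝ (Fin n) := fun k => WithLp.toLp 2 fun j => inner ℝ (a j) (a k)
    with hb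
  have hact : ∀ y j, act b y j = inner ℝ (a j) (act a y) := fun y j => by
    rw [real_inner_comm, inner_act_left]
    simp [act, hb, real_inner_comm]
  have hnorm : ∀ y, ‖act b y‖ ^ 2 = ∑ j, inner ℝ (a j) (act a y) ^ 2 := fun y => by
    rw [EuclideanSpace.real_norm_sq_eq]
    simp [hact]
  have hbD : OpBound b (D ^ 2) := fun y => by
    have h0 : 0 ≤ √(∑ j, y j ^ 2) := Real.sqrt_nonneg _
    refine pow_le_pow_iff_left₀ (norm_nonneg _) (by positivity) two_ne_zero |>.1 ?_
    rw [hnorm]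
    refine (h.sum_inner_sq_le hD _).trans ?_
    rw [pow_two D, mul_assoc]
    gcongr
    exact h y
  have hhs : hsSq b = ∑ j, ∑ k, inner ℝ (a j) (a k) ^ 2 := by
    rw [hsSq, Finset.sum_comm]
    refine Finset.sum_congr rfl fun k _ => ?_
    rw [EuclideanSpace.real_norm_sq_eq]
  have hfm : Measurable fun y => ENNReal.ofReal ‖act b y‖ :=
    (continuous_act b).norm.measurable.ennreal_ofReal
  calc _ ≤ lpN p (stdGauss n) (fun y => ENNReal.ofReal (4 * √p) * ENNReal.ofReal ‖act b y‖) := by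
        refine lpN_prod_le_snd hp ?_ fun y => ?_
        · have := measurable_iSup_bilin (Set.univ : Set Unit) (fun _ => a) (fun _ => a)
          simpa using this
        · rw [← ENNReal.ofReal_mul (by positivity)]
          simp_rw [inner_act_left]
          exact lpN_sum_mul_le _ (norm_nonneg _) (hnorm y).ge hp
    _ = ENNReal.ofReal (4 * √p) * lpN p (stdGauss n) (fun y => ENNReal.ofReal ‖act b y‖) :=
        lpN_const_mul hp _ hfm
    _ ≤ ENNReal.ofReal (4 * √p) * ENNReal.ofReal (√(hsSq b) + 8 * √p * D ^ 2) := by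
        gcongr
        exact lpN_norm_act_le hbD (by positivity) hp
    _ = _ := by
        rw [← ENNReal.ofReal_mul (by positivity), hhs]
        congr 1
        have : √p * √p = p := Real.mul_self_sqrt (by linarith)
        linear_combination 32 * D ^ 2 * this

end Chaos
end

/-! ### Maximal inequality along a chain -/

noncomputable section

namespace Chaos

/-- A maximal inequality for a sequence of finite families of growing cardinality: after
normalization by `2 ^ (k / 2)`, the supremum of all subgaussian variables has bounded moments. -/
lemma lintegral_iSup_rpow_le_two {X κ : Type*} [MeasurableSpace X] {ρ : Measure X}
    [IsProbabilityMeasure ρ] {l : ℕ} {p : ℝ} (hp : 1 ≤ p) (hl : p ≤ 2 ^ (l + 1))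
    (I : ℕ → Finset κ) (hI : ∀ j, (I j).card ≤ 2 ^ 2 ^ (l + j + 2)) {f : κ → X → ℝ≥0∞}
    (hfm : ∀ i, Measurable (f i))
    (hf : ∀ i, ∀ r : ℝ, 1 ≤ r → lpN r ρ (f i) ≤ ENNReal.ofReal (4 * √r)) :
    ∫⁻ x, (⨆ j, ⨆ i ∈ I j, (64 * 2 ^ (((l + j : ℕ) : ℝ) / 2))⁻¹ * f i x) ^ p ∂ρ ≤ 2 := by
  have hp0 : 0 < p := by linarith
  set c : ℕ → ℝ≥0∞ := fun j => 64 * 2 ^ (((l + j : ℕ) : ℝ) / 2) with hc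
  -- The moment order at level `j` is proportional to the logarithm of the cardinality: there are at
  -- most `4 ^ r j` variables, and each normalized `r j`-th moment is at most `8 ^ (-r j)`. Hence
  -- the level contributes at most `2 ^ (-r j)`.
  set r : ℕ → ℕ := fun j => 2 ^ (l + j + 1) with hr
  have hr1 : ∀ j, (1 : ℝ) ≤ r j := fun j => by
    simp only [hr]; exact_mod_cast Nat.one_le_two_pow
  have hpr : ∀ j, p ≤ r j := fun j => hl.trans (by
    simp only [hr]; push_cast
    exact pow_le_pow_right₀ (by norm_num) (by omega))
  -- Values below one are absorbed by the constant `1`; above one, the power `p` may be raised to `r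
  -- j ≥ p`.
  set Q : X → ℝ≥0∞ := fun x => 1 + ∑' j, ∑ i ∈ I j, ((c j)⁻¹ * f i x) ^ (r j : ℝ) with hQ
  have hpt : ∀ x, (⨆ j, ⨆ i ∈ I j, (c j)⁻¹ * f i x) ^ p ≤ Q x := fun x => by
    rw [← ENNReal.le_rpow_inv_iff hp0]
    refine iSup_le fun j => iSup₂_le fun i hi => ?_
    rw [ENNReal.le_rpow_inv_iff hp0]
    set u := (c j)⁻¹ * f i x with hu
    rcases le_total u 1 with h1 | h1
    · exact (ENNReal.rpow_le_one h1 hp0.le).trans le_self_add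
    · calc u ^ p ≤ u ^ (r j : ℝ) := ENNReal.rpow_le_rpow_of_exponent_le h1 (hpr j)
        _ ≤ ∑ i ∈ I j, ((c j)⁻¹ * f i x) ^ (r j : ℝ) :=
            Finset.single_le_sum (f := fun i => ((c j)⁻¹ * f i x) ^ (r j : ℝ))
              (fun _ _ => zero_le) hi
        _ ≤ ∑' j, ∑ i ∈ I j, ((c j)⁻¹ * f i x) ^ (r j : ℝ) := ENNReal.le_tsum j
        _ ≤ Q x := le_add_self
  have hterm : ∀ j i, ∫⁻ x, ((c j)⁻¹ * f i x) ^ (r j : ℝ) ∂ρ ≤ (8⁻¹ : ℝ≥0∞) ^ (r j) := fun j i => by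
    rw [← ENNReal.rpow_natCast, ← lpN_le_iff (hr1 j), lpN_const_mul (hr1 j) _ (hfm i)]
    have h2 : ENNReal.ofReal (4 * √(r j : ℝ)) ≤ 8⁻¹ * c j := by
      have e1 : c j = ENNReal.ofReal (64 * 2 ^ (((l + j : ℕ) : ℝ) / 2)) := by
        rw [ENNReal.ofReal_mul (by norm_num), hc, ← ENNReal.ofReal_rpow_of_pos (by norm_num)]
        norm_num
      have e2 : (8⁻¹ : ℝ≥0∞) = ENNReal.ofReal (8⁻¹) := by
        rw [ENNReal.ofReal_inv_of_pos (by norm_num)]; norm_num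
      rw [e1, e2, ← ENNReal.ofReal_mul (by norm_num)]
      refine ENNReal.ofReal_le_ofReal ?_
      have e3 : √(r j : ℝ) = √2 * 2 ^ (((l + j : ℕ) : ℝ) / 2) := by
        have : (r j : ℝ) = 2 * 2 ^ (l + j) := by simp only [hr]; push_cast; ring
        rw [this, Real.sqrt_mul (by norm_num)]
        congr 1
        rw [Real.sqrt_eq_rpow, ← Real.rpow_natCast, ← Real.rpow_mul (by norm_num)]
        congr 1; ring
      have e4 : √2 ≤ 2 := by rw [Real.sqrt_le_left (by norm_num)]; norm_num
      rw [e3]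
      have : (0 : ℝ) < 2 ^ (((l + j : ℕ) : ℝ) / 2) := by positivity
      nlinarith
    calc (c j)⁻¹ * lpN (r j) ρ (f i) ≤ (c j)⁻¹ * (8⁻¹ * c j) := by
          gcongr; exact (hf i _ (hr1 j)).trans h2
      _ = 8⁻¹ * ((c j)⁻¹ * c j) := by ring
      _ ≤ 8⁻¹ * 1 := by gcongr; exact ENNReal.inv_mul_le_one _
      _ = 8⁻¹ := mul_one _
  have hsum : ∀ j, ∑ i ∈ I j, ∫⁻ x, ((c j)⁻¹ * f i x) ^ (r j : ℝ) ∂ρ ≤ (2⁻¹ : ℝ≥0∞) ^ (j + 1) :=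
    fun j => by
      calc ∑ i ∈ I j, ∫⁻ x, ((c j)⁻¹ * f i x) ^ (r j : ℝ) ∂ρ
          ≤ ∑ i ∈ I j, (8⁻¹ : ℝ≥0∞) ^ (r j) := Finset.sum_le_sum fun i _ => hterm j i
        _ = ((I j).card : ℝ≥0∞) * (8⁻¹ : ℝ≥0∞) ^ (r j) := by simp
        _ ≤ ((2 ^ 2 ^ (l + j + 2) : ℕ) : ℝ≥0∞) * (8⁻¹ : ℝ≥0∞) ^ (r j) := by
            gcongr; exact hI j
        _ = (4 * 8⁻¹ : ℝ≥0∞) ^ (r j) := by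
            rw [mul_pow]
            congr 1
            simp only [hr]
            push_cast
            rw [show (4 : ℝ≥0∞) = 2 ^ 2 by norm_num, ← pow_mul]
            congr 1; ring
        _ = (2⁻¹ : ℝ≥0∞) ^ (r j) := by
            congr 1
            rw [show (8 : ℝ≥0∞) = 4 * 2 by norm_num, ENNReal.mul_inv (by norm_num) (by norm_num),
              ← mul_assoc, ENNReal.mul_inv_cancel (by norm_num) (by norm_num), one_mul]
        _ ≤ (2⁻¹ : ℝ≥0∞) ^ (j + 1) := by
            refine pow_le_pow_right_of_le_one' (by simp) ?_
            have : j + 1 < 2 ^ (j + 1) := Nat.lt_two_pow_self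
            exact this.le.trans (Nat.pow_le_pow_right (by norm_num) (by omega))
  calc _ ≤ ∫⁻ x, Q x ∂ρ := lintegral_mono hpt
    _ = 1 + ∑' j, ∑ i ∈ I j, ∫⁻ x, ((c j)⁻¹ * f i x) ^ (r j : ℝ) ∂ρ := by
        rw [hQ, lintegral_add_left measurable_const, lintegral_const, measure_univ, mul_one,
          lintegral_tsum fun j => (Finset.measurable_fun_sum _ fun i _ =>
            ((hfm i).const_mul _).pow_const _).aemeasurable]
        congr 2; ext j
        rw [lintegral_finsetSum _ fun i _ => ((hfm i).const_mul _).pow_const _]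
    _ ≤ 1 + ∑' j, (2⁻¹ : ℝ≥0∞) ^ (j + 1) := by gcongr with j; exact hsum j
    _ = 2 := by
        rw [ENNReal.tsum_geometric_add_one, ENNReal.one_sub_inv_two, inv_inv,
          ENNReal.inv_mul_cancel (by norm_num) (by norm_num)]
        norm_num

variable {H : Type*} [NormedAddCommGroup H] [InnerProductSpace ℝ H] {n : ℕ}

/-- Moments of the supremum of a chain of Gaussian linear forms. -/
lemma lpN_chain_le {ι : Type*} {S : Set ι} {a : ι → Fin n → H} {d : ι → ι → ℝ}
    (hd0 : ∀ s t, 0 ≤ d s t) (hd : ∀ s t, OpBound (a t - a s) (d s t)) {l : ℕ} {p : ℝ}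
    (hp : 1 ≤ p) (hl : p ≤ 2 ^ (l + 1)) (U : ℕ → Finset ι)
    (hU : ∀ j, (U j).card ≤ 2 ^ 2 ^ (l + j)) (π : ℕ → ι → ι) (hπ : ∀ j, ∀ t ∈ S, π j t ∈ U j)
    (v : ι → ι → H) (N : ℝ≥0∞)
    (hv : ∀ j, ∀ t ∈ S, ENNReal.ofReal ‖v (π j t) (π (j + 1) t)‖ ≤ N) :
    lpN p (stdGauss n) (fun g => ⨆ t ∈ S, ∑' j, ENNReal.ofReal
        |inner ℝ (act (a (π (j + 1) t) - a (π j t)) g) (v (π j t) (π (j + 1) t))|) ≤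
      128 * (⨆ t ∈ S, ∑' j, (2 : ℝ≥0∞) ^ (((l + j : ℕ) : ℝ) / 2) *
        ENNReal.ofReal (d (π j t) (π (j + 1) t))) * N := by
  have hp0 : 0 < p := by linarith
  set μ := stdGauss n
  set Γ := ⨆ t ∈ S, ∑' j, (2 : ℝ≥0∞) ^ (((l + j : ℕ) : ℝ) / 2) *
        ENNReal.ofReal (d (π j t) (π (j + 1) t)) with hΓ
  set Y : ι × ι → (Fin n → ℝ) → ℝ≥0∞ := fun i g =>
    ENNReal.ofReal |inner ℝ (act (a i.2 - a i.1) g) (v i.1 i.2)| with hY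
  set σ : ι × ι → ℝ≥0∞ := fun i => ENNReal.ofReal (d i.1 i.2 * ‖v i.1 i.2‖) with hσ
  have hYm : ∀ i, Measurable (Y i) := fun i =>
    (((continuous_act _).inner continuous_const).abs).measurable.ennreal_ofReal
  set f : ι × ι → (Fin n → ℝ) → ℝ≥0∞ := fun i g => (σ i)⁻¹ * Y i g with hf
  have hfm : ∀ i, Measurable (f i) := fun i => (hYm i).const_mul _
  have hfr : ∀ i, ∀ r : ℝ, 1 ≤ r → lpN r μ (f i) ≤ ENNReal.ofReal (4 * √r) := fun i r hr => by
    rw [lpN_const_mul hr _ (hYm i)]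
    calc (σ i)⁻¹ * lpN r μ (Y i) ≤ (σ i)⁻¹ * (ENNReal.ofReal (4 * √r) * σ i) := by
          gcongr
          rw [hσ, ← ENNReal.ofReal_mul (by positivity)]
          exact (hd i.1 i.2).lpN_inner_le (hd0 _ _) _ hr
      _ = ENNReal.ofReal (4 * √r) * ((σ i)⁻¹ * σ i) := by ring
      _ ≤ ENNReal.ofReal (4 * √r) * 1 := by gcongr; exact ENNReal.inv_mul_le_one _
      _ = _ := mul_one _
  -- For `σ i = 0` the inverse is `∞`, and the bound survives only because the form vanishes
  -- identically.
  have hYf : ∀ i g, Y i g ≤ σ i * f i g := fun i g => by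
    by_cases h0 : σ i = 0
    · have h1 : d i.1 i.2 * ‖v i.1 i.2‖ ≤ 0 := ENNReal.ofReal_eq_zero.1 h0
      have h2 : |inner ℝ (act (a i.2 - a i.1) g) (v i.1 i.2)| ≤ 0 := by
        calc _ ≤ ‖act (a i.2 - a i.1) g‖ * ‖v i.1 i.2‖ := abs_real_inner_le_norm _ _
          _ ≤ (d i.1 i.2 * √(∑ j, g j ^ 2)) * ‖v i.1 i.2‖ := by gcongr; exact hd i.1 i.2 g
          _ = (d i.1 i.2 * ‖v i.1 i.2‖) * √(∑ j, g j ^ 2) := by ring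
          _ ≤ 0 := mul_nonpos_of_nonpos_of_nonneg h1 (Real.sqrt_nonneg _)
      rw [hY]; simp only
      rw [ENNReal.ofReal_eq_zero.2 h2]; exact zero_le
    · rw [hf]; simp only
      rw [← mul_assoc, ENNReal.mul_inv_cancel h0 ENNReal.ofReal_ne_top, one_mul]
  set I : ℕ → Finset (ι × ι) := fun j => U j ×ˢ U (j + 1) with hI
  have hIc : ∀ j, (I j).card ≤ 2 ^ 2 ^ (l + j + 2) := fun j => by
    rw [hI, Finset.card_product]
    calc (U j).card * (U (j + 1)).card ≤ 2 ^ 2 ^ (l + j) * 2 ^ 2 ^ (l + (j + 1)) :=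
          Nat.mul_le_mul (hU j) (hU (j + 1))
      _ = 2 ^ (2 ^ (l + j) + 2 ^ (l + (j + 1))) := (pow_add _ _ _).symm
      -- Pairs of consecutive levels: `2 ^ k + 2 ^ (k + 1) ≤ 2 ^ (k + 2)`.
      _ ≤ _ := by
          refine Nat.pow_le_pow_right (by norm_num) ?_
          rw [← add_assoc, pow_succ, pow_succ, pow_succ]; omega
  set c : ℕ → ℝ≥0∞ := fun j => 64 * 2 ^ (((l + j : ℕ) : ℝ) / 2) with hc
  have hc0 : ∀ j, c j ≠ 0 := fun j => mul_ne_zero (by norm_num)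
    (ENNReal.rpow_pos (by norm_num) (by norm_num)).ne'
  have hct : ∀ j, c j ≠ ∞ := fun j => ENNReal.mul_ne_top (by norm_num)
    (ENNReal.rpow_ne_top_of_nonneg (by positivity) (by norm_num))
  set W : (Fin n → ℝ) → ℝ≥0∞ := fun g => ⨆ j, ⨆ i ∈ I j, (c j)⁻¹ * f i g with hW
  have hWm : Measurable W := Measurable.iSup fun j =>
    Measurable.biSup _ (I j).countable_toSet fun i _ => (hfm i).const_mul _
  have hWp : lpN p μ W ≤ 2 := by
    rw [lpN_le_iff hp]
    refine (lintegral_iSup_rpow_le_two hp hl I hIc hfm hfr).trans ?_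
    calc (2 : ℝ≥0∞) = 2 ^ (1 : ℝ) := by simp
      _ ≤ 2 ^ p := ENNReal.rpow_le_rpow_of_exponent_le (by norm_num) hp
  -- One random variable `W`, independent of `t`, controls every link, so the remaining sum over
  -- levels is deterministic.
  have hpt : ∀ g, (⨆ t ∈ S, ∑' j, Y (π j t, π (j + 1) t) g) ≤ (64 * Γ * N) * W g := fun g => by
    refine iSup₂_le fun t ht => ?_
    have h1 : ∀ j, Y (π j t, π (j + 1) t) g ≤ (2 : ℝ≥0∞) ^ (((l + j : ℕ) : ℝ) / 2) *
        ENNReal.ofReal (d (π j t) (π (j + 1) t)) * (64 * N * W g) := fun j => by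
      set i : ι × ι := (π j t, π (j + 1) t) with hi
      have hiI : i ∈ I j := Finset.mk_mem_product (hπ j t ht) (hπ (j + 1) t ht)
      have h2 : f i g ≤ c j * W g := by
        calc f i g = c j * ((c j)⁻¹ * f i g) := by
              rw [← mul_assoc, ENNReal.mul_inv_cancel (hc0 j) (hct j), one_mul]
          _ ≤ c j * W g := by
              gcongr
              exact le_iSup_of_le j (le_iSup₂ (f := fun i (_ : i ∈ I j) => (c j)⁻¹ * f i g) i hiI)
      calc Y i g ≤ σ i * f i g := hYf i g
        _ ≤ (ENNReal.ofReal (d i.1 i.2) * N) * (c j * W g) := by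
            gcongr
            rw [hσ]; simp only
            rw [ENNReal.ofReal_mul (hd0 _ _)]
            gcongr
            exact hv j t ht
        _ = _ := by rw [hc]; ring
    calc ∑' j, Y (π j t, π (j + 1) t) g
        ≤ ∑' j, (2 : ℝ≥0∞) ^ (((l + j : ℕ) : ℝ) / 2) *
          ENNReal.ofReal (d (π j t) (π (j + 1) t)) * (64 * N * W g) := ENNReal.tsum_le_tsum h1
      _ = (∑' j, (2 : ℝ≥0∞) ^ (((l + j : ℕ) : ℝ) / 2) *
          ENNReal.ofReal (d (π j t) (π (j + 1) t))) * (64 * N * W g) := ENNReal.tsum_mul_right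
      _ ≤ Γ * (64 * N * W g) := by
          gcongr
          exact le_iSup₂ (f := fun t (_ : t ∈ S) => ∑' j, (2 : ℝ≥0∞) ^ (((l + j : ℕ) : ℝ) / 2) *
            ENNReal.ofReal (d (π j t) (π (j + 1) t))) t ht
      _ = _ := by ring
  calc _ ≤ lpN p μ (fun g => (64 * Γ * N) * W g) := lpN_mono hp hpt
    _ = (64 * Γ * N) * lpN p μ W := lpN_const_mul hp _ hWm
    _ ≤ (64 * Γ * N) * 2 := by gcongr
    _ = _ := by ring

end Chaos
end

/-! ### Chaining the decoupled chaos and closing the self-bounding inequality -/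

noncomputable section

namespace Chaos

/-- The maximum is dominated by the `ℓ^p` sum, which loses only the `p`-th root of the cardinality.
This is why the chain can start at level `⌊log₂ p⌋`. -/
lemma lpN_iSup_finset_le {X κ : Type*} [MeasurableSpace X] {ρ : Measure X} {p : ℝ} (hp : 1 ≤ p)
    (U : Finset κ) {f : κ → X → ℝ≥0∞} (hf : ∀ i, Measurable (f i)) {M : ℝ≥0∞}
    (hM : ∀ i ∈ U, lpN p ρ (f i) ≤ M) (hU : ((U.card : ℕ) : ℝ≥0∞) ≤ 2 ^ p) :
    lpN p ρ (fun x => ⨆ i ∈ U, f i x) ≤ 2 * M := by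
  have hp0 : 0 < p := by linarith
  rw [lpN_le_iff hp]
  have hpt : ∀ x, (⨆ i ∈ U, f i x) ^ p ≤ ∑ i ∈ U, f i x ^ p := fun x => by
    rw [← ENNReal.le_rpow_inv_iff hp0]
    refine iSup₂_le fun i hi => ?_
    rw [ENNReal.le_rpow_inv_iff hp0]
    exact Finset.single_le_sum (f := fun i => f i x ^ p) (fun _ _ => zero_le) hi
  calc _ ≤ ∫⁻ x, ∑ i ∈ U, f i x ^ p ∂ρ := lintegral_mono hpt
    _ = ∑ i ∈ U, ∫⁻ x, f i x ^ p ∂ρ := lintegral_finsetSum _ fun i _ => (hf i).pow_const p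
    _ ≤ ∑ i ∈ U, M ^ p := Finset.sum_le_sum fun i hi => (lpN_le_iff hp).1 (hM i hi)
    _ = (U.card : ℝ≥0∞) * M ^ p := by simp
    _ ≤ 2 ^ p * M ^ p := by gcongr
    _ = _ := (ENNReal.mul_rpow_of_nonneg _ _ hp0.le).symm

variable {H : Type*} [NormedAddCommGroup H] [InnerProductSpace ℝ H] {n : ℕ}

lemma measurable_iSup_tsum {X ι : Type*} [TopologicalSpace X] [MeasurableSpace X]
    [OpensMeasurableSpace X] (S : Set ι) {f : ι → ℕ → X → ℝ} (hf : ∀ i j, Continuous (f i j)) :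
    Measurable fun x => ⨆ i ∈ S, ∑' j, ENNReal.ofReal |f i j x| :=
  LowerSemicontinuous.measurable <| lowerSemicontinuous_biSup fun i _ =>
    lowerSemicontinuous_tsum fun j =>
      (ENNReal.continuous_ofReal.comp (hf i j).abs).lowerSemicontinuous

/-- Chaining bound for a decoupled Gaussian chaos. -/
lemma lpN_bilin_iSup_le {ι : Type*} {S : Set ι} (hS : S.Nonempty) {a : ι → Fin n → H}
    {d : ι → ι → ℝ} (hd0 : ∀ s t, 0 ≤ d s t) (hdc : ∀ s t, d s t = d t s)
    (hdt : ∀ r s t, d r t ≤ d r s + d s t) (hd : ∀ s t, OpBound (a t - a s) (d s t))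
    {D : ℝ} (hD0 : 0 ≤ D) (hD : ∀ t ∈ S, OpBound (a t) D) {l : ℕ} {p : ℝ}
    (hp : 1 ≤ p) (hlp : 2 ^ l ≤ p) (hpl : p ≤ 2 ^ (l + 1)) {T : ℕ → Set ι} (hTS : ∀ j, T j ⊆ S)
    (hT : ∀ j, (T j).encard ≤ ((2 ^ 2 ^ (l + j) : ℕ) : ℕ∞)) {M γ : ℝ≥0∞}
    (hM : ∀ t ∈ S, lpN p ((stdGauss n).prod (stdGauss n))
      (fun q => ENNReal.ofReal |inner ℝ (act (a t) q.1) (act (a t) q.2)|) ≤ M)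
    (hγt : ∀ t ∈ S, ∑' j, (2 : ℝ≥0∞) ^ (((l + j : ℕ) : ℝ) / 2) * distTo d t (T j) ≤ γ)
    (hγ : γ ≠ ∞) :
    lpN p ((stdGauss n).prod (stdGauss n))
        (fun q => ⨆ t ∈ S, ENNReal.ofReal |inner ℝ (act (a t) q.1) (act (a t) q.2)|) ≤
      2 * M + 512 * γ * lpN p (stdGauss n) (fun x => ⨆ t ∈ S, ENNReal.ofReal ‖act (a t) x‖) := by
  classical
  set μ := stdGauss n
  set wt : ℕ → ℝ≥0∞ := fun j => (2 : ℝ≥0∞) ^ (((l + j : ℕ) : ℝ) / 2) with hwt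
  have hwt0 : ∀ j, 1 ≤ wt j := fun j => by
    have := ENNReal.rpow_le_rpow_of_exponent_le (x := 2) (by norm_num)
      (show (0 : ℝ) ≤ ((l + j : ℕ) : ℝ) / 2 by positivity)
    rwa [ENNReal.rpow_zero] at this
  have hfin : ∀ j, (T j).Finite := fun j => (Set.encard_le_coe_iff.1 (hT j)).1
  -- The distance to an empty set is `∞`, which the finiteness of `γ` excludes.
  have hne : ∀ j, (T j).Nonempty := fun j => by
    by_contra hcon
    rw [Set.not_nonempty_iff_eq_empty] at hcon
    obtain ⟨t, ht⟩ := hS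
    have h1 : wt j * distTo d t (T j) ≤ γ := (ENNReal.le_tsum j).trans (hγt t ht)
    rw [hcon] at h1
    simp only [distTo, Set.mem_empty_iff_false, not_false_eq_true, iInf_neg, iInf_top] at h1
    rw [ENNReal.mul_top (zero_lt_one.trans_le (hwt0 j)).ne'] at h1
    exact hγ (top_le_iff.1 h1)
  have hπex : ∀ j t, ∃ s, s ∈ T j ∧ ENNReal.ofReal (d t s) ≤ distTo d t (T j) := fun j t => by
    obtain ⟨s, hs, hmin⟩ := Set.exists_min_image (T j) (fun s => d t s) (hfin j) (hne j)
    exact ⟨s, hs, le_iInf₂ fun s' hs' => ENNReal.ofReal_le_ofReal (hmin s' hs')⟩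
  choose π hπT hπd using hπex
  set U : ℕ → Finset ι := fun j => (hfin j).toFinset with hU
  have hUc : ∀ j, (U j).card ≤ 2 ^ 2 ^ (l + j) := fun j => by
    have h1 := hT j
    rw [(hfin j).encard_eq_coe_toFinset_card] at h1
    exact_mod_cast h1
  have hπU : ∀ j, ∀ t ∈ S, π j t ∈ U j := fun j t _ => (hfin j).mem_toFinset.2 (hπT j t)
  have hπS : ∀ j t, π j t ∈ S := fun j t => hTS j (hπT j t)
  set Γ := ⨆ t ∈ S, ∑' j, wt j * ENNReal.ofReal (d (π j t) (π (j + 1) t)) with hΓ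
  -- Triangle inequality through `t`; the second distance is charged to the larger weight of the
  -- next level.
  have hΓγ : Γ ≤ 2 * γ := by
    refine iSup₂_le fun t ht => ?_
    have h1 : ∀ j, wt j * ENNReal.ofReal (d (π j t) (π (j + 1) t)) ≤
        wt j * distTo d t (T j) + wt (j + 1) * distTo d t (T (j + 1)) := fun j => by
      have h2 : ENNReal.ofReal (d (π j t) (π (j + 1) t)) ≤
          distTo d t (T j) + distTo d t (T (j + 1)) := by
        refine le_trans ?_ (add_le_add (hπd j t) (hπd (j + 1) t))
        rw [← ENNReal.ofReal_add (hd0 _ _) (hd0 _ _)]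
        refine ENNReal.ofReal_le_ofReal ((hdt _ t _).trans ?_)
        rw [hdc _ t]
      have h3 : wt j ≤ wt (j + 1) :=
        ENNReal.rpow_le_rpow_of_exponent_le (by norm_num) (by push_cast; linarith)
      calc _ ≤ wt j * (distTo d t (T j) + distTo d t (T (j + 1))) := by gcongr
        _ = wt j * distTo d t (T j) + wt j * distTo d t (T (j + 1)) := mul_add _ _ _
        _ ≤ _ := by gcongr
    refine (ENNReal.tsum_le_tsum h1).trans ?_
    rw [ENNReal.tsum_add, two_mul]
    refine add_le_add (hγt t ht) (le_trans ?_ (hγt t ht))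
    exact ENNReal.tsum_comp_le_tsum_of_injective (add_left_injective 1)
      (fun j => wt j * distTo d t (T j))
  set Nf : (Fin n → ℝ) → ℝ≥0∞ := fun x => ⨆ t ∈ S, ENNReal.ofReal ‖act (a t) x‖ with hNf
  have hNfm : Measurable Nf := measurable_iSup_norm_act S a
  have hN : ∀ x, ∀ t ∈ S, ENNReal.ofReal ‖act (a t) x‖ ≤ Nf x := fun x t ht =>
    le_iSup₂ (f := fun t (_ : t ∈ S) => ENNReal.ofReal ‖act (a t) x‖) t ht
  -- The bilinear increment splits into two parts, each with the matrix difference acting on one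
  -- vector only. Freezing `q.2` in `y₁` and `q.1` in `y₂` leaves linear Gaussian forms.
  set y₁ : ι → ℕ → (Fin n → ℝ) × (Fin n → ℝ) → ℝ := fun t j q =>
    inner ℝ (act (a (π (j + 1) t) - a (π j t)) q.1) (act (a (π (j + 1) t)) q.2) with hy₁
  set y₂ : ι → ℕ → (Fin n → ℝ) × (Fin n → ℝ) → ℝ := fun t j q =>
    inner ℝ (act (a (π (j + 1) t) - a (π j t)) q.2) (act (a (π j t)) q.1) with hy₂
  have hy₁c : ∀ t j, Continuous (y₁ t j) := fun t j =>
    ((continuous_act _).comp continuous_fst).inner ((continuous_act _).comp continuous_snd)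
  have hy₂c : ∀ t j, Continuous (y₂ t j) := fun t j =>
    ((continuous_act _).comp continuous_snd).inner ((continuous_act _).comp continuous_fst)
  set F₁ : (Fin n → ℝ) × (Fin n → ℝ) → ℝ≥0∞ := fun q => ⨆ t ∈ S, ∑' j, ENNReal.ofReal |y₁ t j q|
  set F₂ : (Fin n → ℝ) × (Fin n → ℝ) → ℝ≥0∞ := fun q => ⨆ t ∈ S, ∑' j, ENNReal.ofReal |y₂ t j q|
  set F₀ : (Fin n → ℝ) × (Fin n → ℝ) → ℝ≥0∞ := fun q => ⨆ s ∈ U 0,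
    ENNReal.ofReal |inner ℝ (act (a s) q.1) (act (a s) q.2)|
  have hF₁m : Measurable F₁ := measurable_iSup_tsum S hy₁c
  have hF₂m : Measurable F₂ := measurable_iSup_tsum S hy₂c
  have hF₀m : Measurable F₀ := measurable_iSup_bilin (U 0 : Set ι) a a
  have hF₀ : lpN p (μ.prod μ) F₀ ≤ 2 * M := by
    refine lpN_iSup_finset_le hp (U 0) (fun s => ?_) (fun s hs => hM s ?_) ?_
    · exact (((continuous_act (a s)).comp continuous_fst).inner
        ((continuous_act (a s)).comp continuous_snd)).abs.measurable.ennreal_ofReal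
    · exact hTS 0 ((hfin 0).mem_toFinset.1 hs)
    · calc (((U 0).card : ℕ) : ℝ≥0∞) ≤ ((2 ^ 2 ^ (l + 0) : ℕ) : ℝ≥0∞) := by
            exact_mod_cast hUc 0
        _ = (2 : ℝ≥0∞) ^ (((2 ^ l : ℕ) : ℝ)) := by rw [ENNReal.rpow_natCast]; push_cast; rfl
        _ ≤ 2 ^ p := ENNReal.rpow_le_rpow_of_exponent_le (by norm_num) (by push_cast; exact hlp)
  have hF₁ : lpN p (μ.prod μ) F₁ ≤ 256 * γ * lpN p μ Nf := by
    rw [← lpN_const_mul hp _ hNfm]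
    refine lpN_prod_le_snd hp hF₁m fun y => ?_
    refine (lpN_chain_le hd0 hd hp hpl U hUc π hπU (fun _ t => act (a t) y) (Nf y)
      fun j t _ => hN y _ (hπS _ _)).trans ?_
    calc 128 * Γ * Nf y ≤ 128 * (2 * γ) * Nf y := by gcongr
      _ = _ := by ring
  have hF₂ : lpN p (μ.prod μ) F₂ ≤ 256 * γ * lpN p μ Nf := by
    rw [← lpN_const_mul hp _ hNfm]
    refine lpN_prod_le_fst hp hF₂m fun y => ?_
    refine (lpN_chain_le hd0 hd hp hpl U hUc π hπU (fun t _ => act (a t) y) (Nf y)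
      fun j t _ => hN y _ (hπS _ _)).trans ?_
    calc 128 * Γ * Nf y ≤ 128 * (2 * γ) * Nf y := by gcongr
      _ = _ := by ring
  have hpt : ∀ q : (Fin n → ℝ) × (Fin n → ℝ),
      (⨆ t ∈ S, ENNReal.ofReal |inner ℝ (act (a t) q.1) (act (a t) q.2)|) ≤
        F₀ q + (F₁ q + F₂ q) := fun q => by
    refine iSup₂_le fun t ht => ?_
    set x : ℕ → ℝ := fun j => inner ℝ (act (a (π j t)) q.1) (act (a (π j t)) q.2) with hx
    have hstep : ∀ j, x (j + 1) - x j = y₁ t j q + y₂ t j q := fun j => by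
      simp only [hx, hy₁, hy₂, act_sub_left, inner_sub_left]
      rw [real_inner_comm (act (a (π j t)) q.1) (act (a (π (j + 1) t)) q.2),
        real_inner_comm (act (a (π j t)) q.1) (act (a (π j t)) q.2)]
      ring
    have hpart : ∀ J, ENNReal.ofReal |x J| ≤ ENNReal.ofReal |x 0| +
        ∑ j ∈ Finset.range J, (ENNReal.ofReal |y₁ t j q| + ENNReal.ofReal |y₂ t j q|) := fun J => by
      induction J with
      | zero => simp
      | succ J ih =>
        rw [Finset.sum_range_succ, ← add_assoc]
        refine le_trans ?_ (add_le_add_left ih _)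
        rw [← ENNReal.ofReal_add (abs_nonneg _) (abs_nonneg _),
          ← ENNReal.ofReal_add (abs_nonneg _) (by positivity)]
        refine ENNReal.ofReal_le_ofReal ?_
        have h1 : x (J + 1) = x J + (y₁ t J q + y₂ t J q) := by rw [← hstep]; ring
        rw [h1]
        exact (abs_add_le _ _).trans (by gcongr; exact abs_add_le _ _)
    have hpart' : ∀ J, ENNReal.ofReal |x J| ≤ F₀ q + (F₁ q + F₂ q) := fun J => by
      refine (hpart J).trans (add_le_add ?_ ?_)
      · exact le_iSup₂ (f := fun s (_ : s ∈ U 0) =>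
          ENNReal.ofReal |inner ℝ (act (a s) q.1) (act (a s) q.2)|) (π 0 t) (hπU 0 t ht)
      · refine (ENNReal.sum_le_tsum _).trans ?_
        rw [ENNReal.tsum_add]
        refine add_le_add ?_ ?_
        · exact le_iSup₂ (f := fun t (_ : t ∈ S) => ∑' j, ENNReal.ofReal |y₁ t j q|) t ht
        · exact le_iSup₂ (f := fun t (_ : t ∈ S) => ∑' j, ENNReal.ofReal |y₂ t j q|) t ht
    set R : ℝ := 2 * D * √(∑ j, q.1 j ^ 2) * √(∑ j, q.2 j ^ 2) with hR
    -- The remainder after `J` links is at most the distance to `T J` times a factor `R` independent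
    -- of `J`. It tends to zero since the weighted distances are summable and the weights are at
    -- least one.
    have hlast : ∀ J, ENNReal.ofReal |inner ℝ (act (a t) q.1) (act (a t) q.2)| ≤
        (F₀ q + (F₁ q + F₂ q)) + distTo d t (T J) * ENNReal.ofReal R := fun J => by
      have h1 : inner ℝ (act (a t) q.1) (act (a t) q.2) = x J +
          (inner ℝ (act (a t - a (π J t)) q.1) (act (a t) q.2) +
            inner ℝ (act (a (π J t)) q.1) (act (a t - a (π J t)) q.2)) := by
        simp only [hx, act_sub_left, inner_sub_left, inner_sub_right]; ring
      have h2 : |inner ℝ (act (a t - a (π J t)) q.1) (act (a t) q.2)| ≤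
          (d t (π J t) * √(∑ j, q.1 j ^ 2)) * (D * √(∑ j, q.2 j ^ 2)) :=
        (abs_real_inner_le_norm _ _).trans (mul_le_mul (by
          rw [hdc]; exact hd _ _ _) (hD t ht _) (norm_nonneg _)
          (mul_nonneg (hd0 _ _) (Real.sqrt_nonneg _)))
      have h3 : |inner ℝ (act (a (π J t)) q.1) (act (a t - a (π J t)) q.2)| ≤
          (D * √(∑ j, q.1 j ^ 2)) * (d t (π J t) * √(∑ j, q.2 j ^ 2)) :=
        (abs_real_inner_le_norm _ _).trans (mul_le_mul (hD _ (hπS J t) _) (by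
          rw [hdc]; exact hd _ _ _) (norm_nonneg _) (by positivity))
      calc _ ≤ ENNReal.ofReal (|x J| + d t (π J t) * R) := by
            refine ENNReal.ofReal_le_ofReal ?_
            rw [h1]
            refine (abs_add_le _ _).trans ?_
            gcongr
            refine (abs_add_le _ _).trans ((add_le_add h2 h3).trans_eq ?_)
            rw [hR]; ring
        _ ≤ _ := by
            rw [ENNReal.ofReal_add (abs_nonneg _) (mul_nonneg (hd0 _ _) (by positivity)),
              ENNReal.ofReal_mul (hd0 _ _)]
            gcongr
            · exact hpart' J
            · exact hπd J t
    have htend : Filter.Tendsto (fun J => (F₀ q + (F₁ q + F₂ q)) +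
        distTo d t (T J) * ENNReal.ofReal R) Filter.atTop (nhds (F₀ q + (F₁ q + F₂ q))) := by
      have h1 := ENNReal.tendsto_atTop_zero_of_tsum_ne_top ((hγt t ht).trans_lt hγ.lt_top).ne
      have h2 : Filter.Tendsto (fun J => distTo d t (T J)) Filter.atTop (nhds 0) := by
        refine tendsto_of_tendsto_of_tendsto_of_le_of_le tendsto_const_nhds h1
          (fun _ => zero_le) fun J => ?_
        exact le_mul_of_one_le_left zero_le (hwt0 J)
      have h3 := ENNReal.Tendsto.mul_const h2 (Or.inr (ENNReal.ofReal_ne_top (r := R)))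
      have h4 := h3.const_add (F₀ q + (F₁ q + F₂ q))
      simpa using h4
    exact ge_of_tendsto' htend hlast
  calc _ ≤ lpN p (μ.prod μ) (fun q => F₀ q + (F₁ q + F₂ q)) := lpN_mono hp hpt
    _ ≤ lpN p (μ.prod μ) F₀ + lpN p (μ.prod μ) (fun q => F₁ q + F₂ q) :=
        lpN_add_le hp hF₀m.aemeasurable (hF₁m.add hF₂m).aemeasurable
    _ ≤ lpN p (μ.prod μ) F₀ + (lpN p (μ.prod μ) F₁ + lpN p (μ.prod μ) F₂) := by
        gcongr
        exact lpN_add_le hp hF₁m.aemeasurable hF₂m.aemeasurable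
    _ ≤ 2 * M + (256 * γ * lpN p μ Nf + 256 * γ * lpN p μ Nf) := by gcongr
    _ = _ := by ring

/-- Solving the quadratic inequality gives `y ≤ D₂ + 2 √M + 1024 γ`. The product `2 * 1024 γ * √M`
is then split by the arithmetic-geometric mean inequality. -/
lemma chaos_numeric_bound {y γ D₂ M : ℝ} (hγ : 0 ≤ γ) (hD₂ : 0 ≤ D₂) (hM : 0 ≤ M)
    (h : y ^ 2 ≤ D₂ ^ 2 + 2 * (2 * M + 512 * γ * y)) :
    2 * (2 * M + 512 * γ * y) ≤ 5 * M + 2 * (1024 * γ) ^ 2 + 1024 * γ * D₂ := by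
  have h1 : y ≤ √(D₂ ^ 2 + 4 * M) + 1024 * γ :=
    le_sqrt_add_of_sq_le (by positivity) (by positivity) (by linarith)
  have h2 : √(D₂ ^ 2 + 4 * M) ≤ D₂ + 2 * √M := by
    rw [Real.sqrt_le_left (by positivity)]
    have := Real.sq_sqrt hM
    nlinarith [Real.sqrt_nonneg M]
  have h3 : 1024 * γ * y ≤ 1024 * γ * (D₂ + 2 * √M + 1024 * γ) := by
    gcongr; linarith
  have h4 := Real.sq_sqrt hM
  nlinarith [sq_nonneg (1024 * γ - √M)]

/-- Moments of the supremum of a Gaussian chaos. -/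
lemma lpN_dev_iSup_le {ι : Type*} {S : Set ι} (hS : S.Nonempty) {a : ι → Fin n → H}
    {d : ι → ι → ℝ} (hd0 : ∀ s t, 0 ≤ d s t) (hdc : ∀ s t, d s t = d t s)
    (hdt : ∀ r s t, d r t ≤ d r s + d s t) (hd : ∀ s t, OpBound (a t - a s) (d s t))
    {D D₂ F : ℝ} (hD0 : 0 ≤ D) (hD : ∀ t ∈ S, OpBound (a t) D)
    (hD₂0 : 0 ≤ D₂) (hD₂ : ∀ t ∈ S, hsSq (a t) ≤ D₂ ^ 2) (hF0 : 0 ≤ F)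
    (hF : ∀ t ∈ S, √(∑ j, ∑ k, inner ℝ (a t j) (a t k) ^ 2) ≤ F) {l : ℕ} {p : ℝ}
    (hp : 1 ≤ p) (hlp : 2 ^ l ≤ p) (hpl : p ≤ 2 ^ (l + 1)) {T : ℕ → Set ι} (hTS : ∀ j, T j ⊆ S)
    (hT : ∀ j, (T j).encard ≤ ((2 ^ 2 ^ (l + j) : ℕ) : ℕ∞)) {γ : ℝ} (hγ0 : 0 ≤ γ)
    (hγt : ∀ t ∈ S, ∑' j, (2 : ℝ≥0∞) ^ (((l + j : ℕ) : ℝ) / 2) * distTo d t (T j) ≤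
      ENNReal.ofReal γ) :
    lpN p (stdGauss n) (fun x => ⨆ t ∈ S, ENNReal.ofReal |‖act (a t) x‖ ^ 2 - hsSq (a t)|) ≤
      ENNReal.ofReal (2097152 * (γ ^ 2 + D₂ * γ + √p * F + p * D ^ 2)) := by
  have hp0 : 0 < p := by linarith
  set μ := stdGauss n
  set M : ℝ := 4 * √p * F + 32 * p * D ^ 2 with hMdef
  have hM0 : 0 ≤ M := by positivity
  have hM : ∀ t ∈ S, lpN p (μ.prod μ)
      (fun q => ENNReal.ofReal |inner ℝ (act (a t) q.1) (act (a t) q.2)|) ≤ ENNReal.ofReal M :=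
    fun t ht => (lpN_bilin_le (hD t ht) hD0 hp).trans (ENNReal.ofReal_le_ofReal (by
      rw [hMdef]; gcongr; exact hF t ht))
  set Nf : (Fin n → ℝ) → ℝ≥0∞ := fun x => ⨆ t ∈ S, ENNReal.ofReal ‖act (a t) x‖ with hNf
  have hNfm : Measurable Nf := measurable_iSup_norm_act S a
  have h2p : (1 : ℝ) ≤ 2 * p := by linarith
  have hy := lpN_iSup_norm_act_lt_top S a hD0 hD h2p
  set y := (lpN (2 * p) μ Nf).toReal with hydef
  have hy' : lpN (2 * p) μ Nf = ENNReal.ofReal y := (ENNReal.ofReal_toReal hy.ne).symm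
  have hy0 : 0 ≤ y := ENNReal.toReal_nonneg
  set dv : (Fin n → ℝ) → ℝ≥0∞ :=
    fun x => ⨆ t ∈ S, ENNReal.ofReal |‖act (a t) x‖ ^ 2 - hsSq (a t)| with hdv
  have hdvm : Measurable dv := measurable_iSup_dev S a
  have hdev : lpN p μ dv ≤ ENNReal.ofReal (2 * (2 * M + 512 * γ * y)) := by
    refine (lpN_dev_le_bilin S a hp).trans ?_
    rw [ENNReal.ofReal_mul (by norm_num), ENNReal.ofReal_ofNat]
    gcongr
    refine (lpN_bilin_iSup_le hS hd0 hdc hdt hd hD0 hD hp hlp hpl hTS hT hM hγt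
      ENNReal.ofReal_ne_top).trans ?_
    have e1 : ENNReal.ofReal (2 * M + 512 * γ * y) =
        2 * ENNReal.ofReal M + 512 * ENNReal.ofReal γ * ENNReal.ofReal y := by
      rw [ENNReal.ofReal_add (mul_nonneg zero_le_two hM0) (by positivity),
        ENNReal.ofReal_mul zero_le_two, ENNReal.ofReal_mul (mul_nonneg (by norm_num) hγ0),
        ENNReal.ofReal_mul (by norm_num), ENNReal.ofReal_ofNat, ENNReal.ofReal_ofNat]
    rw [e1, ← hy']
    gcongr
    exact lpN_le_lpN hp (by linarith) hNfm.aemeasurable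
  -- The supremum of the squared norms is at most `D₂ ^ 2` plus the supremum of the deviations,
  -- which `hdev` bounds through `y` again.
  have hsq : ENNReal.ofReal y ^ 2 ≤ ENNReal.ofReal (D₂ ^ 2) +
      ENNReal.ofReal (2 * (2 * M + 512 * γ * y)) := by
    rw [← hy', ← lpN_sq hp]
    calc lpN p μ (fun x => Nf x ^ 2) ≤ lpN p μ (fun x => ENNReal.ofReal (D₂ ^ 2) + dv x) := by
          refine lpN_mono hp fun x => ?_
          rw [← ENNReal.rpow_natCast, ← ENNReal.le_rpow_inv_iff (by norm_num)]
          refine iSup₂_le fun t ht => ?_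
          rw [ENNReal.le_rpow_inv_iff (by norm_num), ENNReal.rpow_natCast,
            ← ENNReal.ofReal_pow (norm_nonneg _)]
          calc ENNReal.ofReal (‖act (a t) x‖ ^ 2)
              ≤ ENNReal.ofReal (D₂ ^ 2 + |‖act (a t) x‖ ^ 2 - hsSq (a t)|) := by
                refine ENNReal.ofReal_le_ofReal ?_
                have h1 := le_abs_self (‖act (a t) x‖ ^ 2 - hsSq (a t))
                have h2 := hD₂ t ht
                linarith
            _ ≤ _ := by
                rw [ENNReal.ofReal_add (by positivity) (abs_nonneg _)]
                gcongr
                exact le_iSup₂ (f := fun t (_ : t ∈ S) =>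
                  ENNReal.ofReal |‖act (a t) x‖ ^ 2 - hsSq (a t)|) t ht
      _ ≤ _ := lpN_add_le hp aemeasurable_const hdvm.aemeasurable
      _ ≤ _ := by rw [lpN_const hp]; gcongr
  rw [← ENNReal.ofReal_pow hy0, ← ENNReal.ofReal_add (by positivity) (by positivity),
    ENNReal.ofReal_le_ofReal_iff (by positivity)] at hsq
  -- The final constant is `2 * 1024 ^ 2`, the coefficient of `γ ^ 2`; it dwarfs the others.
  refine hdev.trans (ENNReal.ofReal_le_ofReal ((chaos_numeric_bound hγ0 hD₂0 hM0 hsq).trans ?_))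
  have e1 : 0 ≤ √p * F := by positivity
  have e2 : 0 ≤ p * D ^ 2 := by positivity
  have e3 : 0 ≤ D₂ * γ := by positivity
  rw [hMdef]
  nlinarith [sq_nonneg γ]

end Chaos
end

/-! ### Schatten norms, radii and the Orlicz norm -/

noncomputable section

namespace Chaos

variable {m n : ℕ}

/-- The columns of a matrix. -/
def col (A : Matrix (Fin m) (Fin n) ℂ) (j : Fin n) : EuclideanSpace ℂ (Fin m) :=
  WithLp.toLp 2 fun i => A i j

lemma act_col (A : Matrix (Fin m) (Fin n) ℂ) (x : Fin n → ℝ) :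
    act (col A) x = WithLp.toLp 2 (A *ᵥ fun j => (x j : ℂ)) := by
  ext i
  simp [act, col, Matrix.mulVec, dotProduct, mul_comm]

lemma col_sub (A B : Matrix (Fin m) (Fin n) ℂ) : col A - col B = col (A - B) := by
  ext j i; simp [col]

lemma schattenNorm_top (A : Matrix (Fin m) (Fin n) ℂ) :
    schattenNorm ∞ A = ‖LinearMap.toContinuousLinearMap (Matrix.toEuclideanLin A)‖ := by
  simp [schattenNorm]

lemma schattenNorm_top_nonneg (A : Matrix (Fin m) (Fin n) ℂ) : 0 ≤ schattenNorm ∞ A := by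
  rw [schattenNorm_top]; exact norm_nonneg _

lemma opBound_col (A : Matrix (Fin m) (Fin n) ℂ) : OpBound (col A) (schattenNorm ∞ A) := by
  intro x
  rw [act_col, schattenNorm_top]
  have h := (LinearMap.toContinuousLinearMap (Matrix.toEuclideanLin A)).le_opNorm
    (WithLp.toLp 2 fun j => (x j : ℂ))
  have e : ‖(WithLp.toLp 2 fun j => (x j : ℂ) : EuclideanSpace ℂ (Fin n))‖ = √(∑ j, x j ^ 2) := by
    rw [EuclideanSpace.norm_eq]; simp
  rw [e] at h
  simpa [Matrix.toEuclideanLin] using h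

lemma OpBound.mono {H : Type*} [NormedAddCommGroup H] [InnerProductSpace ℝ H] {a : Fin n → H}
    {D E : ℝ} (h : OpBound a D) (hDE : D ≤ E) : OpBound a E := fun x =>
  (h x).trans (by gcongr)

lemma schattenNorm_top_neg (A : Matrix (Fin m) (Fin n) ℂ) :
    schattenNorm ∞ (-A) = schattenNorm ∞ A := by
  simp [schattenNorm_top]

lemma schattenNorm_top_add_le (A B : Matrix (Fin m) (Fin n) ℂ) :
    schattenNorm ∞ (A + B) ≤ schattenNorm ∞ A + schattenNorm ∞ B := by
  simp only [schattenNorm_top, map_add]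
  exact norm_add_le _ _

lemma schattenDist_comm (A B : Matrix (Fin m) (Fin n) ℂ) :
    schattenDist ∞ A B = schattenDist ∞ B A := by
  rw [schattenDist, schattenDist, ← schattenNorm_top_neg, neg_sub]

lemma schattenDist_triangle (A B C : Matrix (Fin m) (Fin n) ℂ) :
    schattenDist ∞ A C ≤ schattenDist ∞ A B + schattenDist ∞ B C := by
  rw [schattenDist, schattenDist, schattenDist, ← sub_add_sub_cancel A B C]
  exact schattenNorm_top_add_le _ _

lemma schattenNorm_top_pos {A : Matrix (Fin m) (Fin n) ℂ} (hA : A ≠ 0) : 0 < schattenNorm ∞ A := by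
  rw [schattenNorm_top, norm_pos_iff]
  simpa using hA

lemma trace_conjTranspose_mul_self_re {k : ℕ} (A : Matrix (Fin k) (Fin n) ℂ) :
    (Aᴴ * A).trace.re = ∑ j, ∑ i, ‖A i j‖ ^ 2 := by
  simp only [Matrix.trace, Matrix.diag_apply, Matrix.mul_apply, Matrix.conjTranspose_apply,
    Complex.re_sum]
  refine Finset.sum_congr rfl fun j _ => Finset.sum_congr rfl fun i _ => ?_
  rw [← Complex.normSq_eq_norm_sq, Complex.star_def, mul_comm, Complex.mul_conj]
  simp

lemma schattenNorm_two_sq (A : Matrix (Fin m) (Fin n) ℂ) :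
    schattenNorm 2 A ^ 2 = hsSq (col A) := by
  have hsa : IsSelfAdjoint (Aᴴ * A) := (Matrix.isHermitian_conjTranspose_mul_self A)
  have h1 : cfc (fun x : ℝ => x ^ ((2 : ℝ≥0∞).toReal / 2)) (Aᴴ * A) = Aᴴ * A := by
    simp only [ENNReal.toReal_ofNat]
    norm_num
    exact cfc_id' ℝ (Aᴴ * A)
  have h2 : hsSq (col A) = ∑ j, ∑ i, ‖A i j‖ ^ 2 := by
    simp [hsSq, col, EuclideanSpace.norm_sq_eq]
  rw [schattenNorm, if_neg (by norm_num), h1, trace_conjTranspose_mul_self_re, h2,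
    ENNReal.toReal_ofNat, ← Real.sqrt_eq_rpow, Real.sq_sqrt]
  positivity

lemma schattenNorm_four (A : Matrix (Fin m) (Fin n) ℂ) :
    schattenNorm 4 A = (∑ j, ∑ k, ‖(Aᴴ * A) k j‖ ^ 2) ^ (1 / 4 : ℝ) := by
  have hH := Matrix.isHermitian_conjTranspose_mul_self A
  have hsa : IsSelfAdjoint (Aᴴ * A) := hH
  have h1 : cfc (fun x : ℝ => x ^ ((4 : ℝ≥0∞).toReal / 2)) (Aᴴ * A) = (Aᴴ * A) ^ 2 := by
    have e : (fun x : ℝ => x ^ ((4 : ℝ≥0∞).toReal / 2)) = fun x : ℝ => x ^ 2 := by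
      ext x
      rw [ENNReal.toReal_ofNat, show (4 : ℝ) / 2 = ((2 : ℕ) : ℝ) by norm_num, Real.rpow_natCast]
    rw [e]
    exact cfc_pow_id (R := ℝ) (Aᴴ * A) 2
  have h2 : (Aᴴ * A) ^ 2 = (Aᴴ * A)ᴴ * (Aᴴ * A) := by rw [pow_two, hH.eq]
  rw [schattenNorm, if_neg (by norm_num), h1, h2, trace_conjTranspose_mul_self_re,
    ENNReal.toReal_ofNat]

lemma schattenNorm_four_nonneg (A : Matrix (Fin m) (Fin n) ℂ) : 0 ≤ schattenNorm 4 A := by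
  rw [schattenNorm_four]; positivity

lemma schattenNorm_four_sq (A : Matrix (Fin m) (Fin n) ℂ) :
    schattenNorm 4 A ^ 2 = √(∑ j, ∑ k, ‖(Aᴴ * A) k j‖ ^ 2) := by
  rw [schattenNorm_four, Real.sqrt_eq_rpow, ← Real.rpow_natCast, ← Real.rpow_mul (by positivity)]
  norm_num

lemma conjTranspose_mul_self_apply (A : Matrix (Fin m) (Fin n) ℂ) (j k : Fin n) :
    (Aᴴ * A) k j = inner ℂ (col A k) (col A j) := by
  simp [Matrix.mul_apply, col, PiLp.inner_apply, mul_comm]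

lemma re_conjTranspose_mul_self_apply (A : Matrix (Fin m) (Fin n) ℂ) (j k : Fin n) :
    ((Aᴴ * A) k j).re = inner ℝ (col A j) (col A k) := by
  simp [Matrix.mul_apply, col, PiLp.inner_apply, Complex.inner, Complex.re_sum]

/-- Real inner products of columns are the real parts of the entries of `A* A`, whose Frobenius norm
is `‖A‖_{S^4} ^ 2`. -/
lemma sqrt_sum_inner_sq_le (A : Matrix (Fin m) (Fin n) ℂ) :
    √(∑ j, ∑ k, inner ℝ (col A j) (col A k) ^ 2) ≤ schattenNorm 4 A ^ 2 := by
  rw [schattenNorm_four_sq]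
  refine Real.sqrt_le_sqrt (Finset.sum_le_sum fun j _ => Finset.sum_le_sum fun k _ => ?_)
  rw [← re_conjTranspose_mul_self_apply, ← sq_abs]
  gcongr
  exact Complex.abs_re_le_norm _

lemma norm_col_le (A : Matrix (Fin m) (Fin n) ℂ) (j : Fin n) : ‖col A j‖ ≤ schattenNorm ∞ A := by
  have h := opBound_col A (Pi.single j 1)
  have e1 : act (col A) (Pi.single j 1) = col A j := by
    simp [act, Pi.single_apply]
  have e2 : ∑ i, (Pi.single j (1 : ℝ) : Fin n → ℝ) i ^ 2 = 1 := by
    simp [Pi.single_apply]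
  rw [e1, e2] at h
  simpa using h

lemma hsSq_col_le (A : Matrix (Fin m) (Fin n) ℂ) :
    hsSq (col A) ≤ n * schattenNorm ∞ A ^ 2 := by
  calc hsSq (col A) ≤ ∑ j : Fin n, schattenNorm ∞ A ^ 2 :=
        Finset.sum_le_sum fun j _ => by have := norm_col_le A j; gcongr
    _ = _ := by simp

lemma schattenNorm_four_sq_le (A : Matrix (Fin m) (Fin n) ℂ) :
    schattenNorm 4 A ^ 2 ≤ n * schattenNorm ∞ A ^ 2 := by
  rw [schattenNorm_four_sq, Real.sqrt_le_left (by positivity)]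
  calc ∑ j, ∑ k, ‖(Aᴴ * A) k j‖ ^ 2 ≤ ∑ j : Fin n, ∑ k : Fin n, (schattenNorm ∞ A ^ 2) ^ 2 := by
        refine Finset.sum_le_sum fun j _ => Finset.sum_le_sum fun k _ => ?_
        have h1 := norm_col_le A j
        have h2 := norm_col_le A k
        gcongr
        rw [conjTranspose_mul_self_apply, pow_two]
        exact (norm_inner_le_norm _ _).trans
          (mul_le_mul h2 h1 (norm_nonneg _) (schattenNorm_top_nonneg A))
    _ = _ := by simp; ring

lemma schattenNorm_two_nonneg (A : Matrix (Fin m) (Fin n) ℂ) : 0 ≤ schattenNorm 2 A := by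
  have hsa : IsSelfAdjoint (Aᴴ * A) := (Matrix.isHermitian_conjTranspose_mul_self A)
  have h1 : cfc (fun x : ℝ => x ^ ((2 : ℝ≥0∞).toReal / 2)) (Aᴴ * A) = Aᴴ * A := by
    simp only [ENNReal.toReal_ofNat]
    norm_num
    exact cfc_id' ℝ (Aᴴ * A)
  rw [schattenNorm, if_neg (by norm_num), h1, trace_conjTranspose_mul_self_re]
  positivity

lemma schattenNorm_le_radius {q : ℝ≥0∞} {𝒜 : Set (Matrix (Fin m) (Fin n) ℂ)}
    (h : radius q 𝒜 ≠ ∞) {A : Matrix (Fin m) (Fin n) ℂ} (hA : A ∈ 𝒜) :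
    schattenNorm q A ≤ (radius q 𝒜).toReal := by
  have h1 : ENNReal.ofReal (schattenNorm q A) ≤ radius q 𝒜 :=
    le_iSup₂ (f := fun A (_ : A ∈ 𝒜) => ENNReal.ofReal (schattenNorm q A)) A hA
  exact (ENNReal.ofReal_le_iff_le_toReal h).1 h1

/-- Only finiteness is at stake, so a comparison depending on the dimension suffices. -/
lemma radius_ne_top_of_sq_le {q : ℝ≥0∞} {𝒜 : Set (Matrix (Fin m) (Fin n) ℂ)}
    (h : radius ∞ 𝒜 ≠ ∞)
    (hq : ∀ A : Matrix (Fin m) (Fin n) ℂ, schattenNorm q A ^ 2 ≤ n * schattenNorm ∞ A ^ 2) :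
    radius q 𝒜 ≠ ∞ := by
  refine ne_top_of_le_ne_top (ENNReal.ofReal_ne_top (r := √n * (radius ∞ 𝒜).toReal))
    (iSup₂_le fun A hA => ENNReal.ofReal_le_ofReal ?_)
  have h1 := schattenNorm_le_radius h hA
  have h0 := schattenNorm_top_nonneg A
  refine le_trans ?_ (mul_le_mul_of_nonneg_left h1 (Real.sqrt_nonneg _))
  refine le_of_sq_le_sq ?_ (by positivity)
  rw [mul_pow, Real.sq_sqrt (by positivity)]
  exact hq A

lemma gammaTrunc_le_gammaFun {M : Type*} (α p : ℝ) (d : M → M → ℝ) (S : Set M) :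
    gammaTrunc α p d S ≤ gammaFun α d S :=
  iInf₂_mono fun T _ => iSup₂_mono fun t _ =>
    ENNReal.tsum_comp_le_tsum_of_injective Subtype.val_injective
      (fun k : ℕ => (2 : ℝ≥0∞) ^ ((k : ℝ) / α) * distTo d t (T k))

/-- The zeroth set of an admissible sequence is a single matrix `B`, and the term `k = 0` bounds the
distance of every `A` to `B`. -/
lemma radius_top_ne_top {𝒜 : Set (Matrix (Fin m) (Fin n) ℂ)}
    (h : gammaFun 2 (schattenDist ∞) 𝒜 < ∞) : radius ∞ 𝒜 ≠ ∞ := by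
  obtain ⟨T, hT⟩ := iInf_lt_iff.1 h
  obtain ⟨hadm, hlt⟩ := iInf_lt_iff.1 hT
  obtain ⟨B, hB⟩ := Set.encard_eq_one.1 hadm.card_zero
  refine ne_top_of_le_ne_top (ENNReal.add_ne_top.2 ⟨hlt.ne,
    ENNReal.ofReal_ne_top (r := schattenNorm ∞ B)⟩) (iSup₂_le fun A hA => ?_)
  have h1 := le_iSup₂ (f := fun t (_ : t ∈ 𝒜) =>
    ∑' k : ℕ, (2 : ℝ≥0∞) ^ ((k : ℝ) / 2) * distTo (schattenDist ∞) t (T k)) A hA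
  have h2 : ENNReal.ofReal (schattenDist ∞ A B) ≤
      ∑' k : ℕ, (2 : ℝ≥0∞) ^ ((k : ℝ) / 2) * distTo (schattenDist ∞) A (T k) := by
    refine le_trans ?_ (ENNReal.le_tsum 0)
    simp [hB, distTo]
  calc ENNReal.ofReal (schattenNorm ∞ A)
      ≤ ENNReal.ofReal (schattenDist ∞ A B + schattenNorm ∞ B) := by
        refine ENNReal.ofReal_le_ofReal ?_
        have := schattenNorm_top_add_le (A - B) B
        rwa [sub_add_cancel] at this
    _ ≤ ENNReal.ofReal (schattenDist ∞ A B) + ENNReal.ofReal (schattenNorm ∞ B) :=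
        ENNReal.ofReal_add_le
    _ ≤ _ := by gcongr; exact h2.trans h1

section PsiNorm

variable {Ω : Type*} [MeasurableSpace Ω] {P : Measure Ω} [IsProbabilityMeasure P]

/-- The strict inequality provides an admissible constant below `K`, so attainment of the infimum is
not needed. -/
lemma lintegral_exp_le_two_of_psiNorm_lt {X : Ω → ℝ} {K : ℝ}
    (h : psiNorm P 2 X < ENNReal.ofReal K) :
    ∫⁻ ω, ENNReal.ofReal (Real.exp ((X ω / K) ^ 2)) ∂P ≤ 2 := by
  obtain ⟨C, hC⟩ := iInf_lt_iff.1 h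
  obtain ⟨hC0, hC1⟩ := iInf_lt_iff.1 hC
  obtain ⟨hint, hCK⟩ := iInf_lt_iff.1 hC1
  have hCK' : C < K := (ENNReal.ofReal_lt_ofReal_iff_of_nonneg hC0.le).1 hCK
  calc ∫⁻ ω, ENNReal.ofReal (Real.exp ((X ω / K) ^ 2)) ∂P
      ≤ ∫⁻ ω, (ENNReal.ofReal (Real.exp ((|X ω| / C) ^ (2 : ℝ)) - 1) + 1) ∂P := by
        refine lintegral_mono fun ω => ?_
        rw [← ENNReal.ofReal_one, ← ENNReal.ofReal_add]
        · refine ENNReal.ofReal_le_ofReal ?_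
          rw [sub_add_cancel]
          refine Real.exp_le_exp.2 ?_
          have hK0 : 0 < K := hC0.trans hCK'
          rw [← sq_abs, abs_div, abs_of_pos hK0, Real.rpow_two]
          gcongr
        · rw [sub_nonneg]; exact Real.one_le_exp (by positivity)
        · norm_num
    _ = ∫⁻ ω, ENNReal.ofReal (Real.exp ((|X ω| / C) ^ (2 : ℝ)) - 1) ∂P + 1 := by
        rw [lintegral_add_right _ measurable_const]; simp
    _ ≤ 1 + 1 := by gcongr
    _ = 2 := by norm_num

/-- From `z ≤ exp z` the second moment is at most `2 K ^ 2` for every `K > 0`. -/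
lemma ae_eq_zero_of_psiNorm_eq_zero {X : Ω → ℝ} (hX : Measurable X) (h : psiNorm P 2 X = 0) :
    X =ᵐ[P] 0 := by
  have h1 : ∀ K : ℝ, 0 < K → ∫⁻ ω, ENNReal.ofReal (X ω ^ 2) ∂P ≤ ENNReal.ofReal (2 * K ^ 2) := by
    intro K hK
    have h2 := lintegral_exp_le_two_of_psiNorm_lt (P := P) (X := X) (K := K)
      (by rw [h]; simpa using hK)
    calc ∫⁻ ω, ENNReal.ofReal (X ω ^ 2) ∂P
        ≤ ∫⁻ ω, ENNReal.ofReal (K ^ 2) * ENNReal.ofReal (Real.exp ((X ω / K) ^ 2)) ∂P := by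
          refine lintegral_mono fun ω => ?_
          rw [← ENNReal.ofReal_mul (by positivity)]
          refine ENNReal.ofReal_le_ofReal ?_
          have h3 := Real.add_one_le_exp ((X ω / K) ^ 2)
          calc X ω ^ 2 = K ^ 2 * (X ω / K) ^ 2 := by field_simp
            _ ≤ _ := by gcongr; linarith
      _ = ENNReal.ofReal (K ^ 2) * ∫⁻ ω, ENNReal.ofReal (Real.exp ((X ω / K) ^ 2)) ∂P :=
          lintegral_const_mul _ (by fun_prop)
      _ ≤ ENNReal.ofReal (K ^ 2) * 2 := by gcongr
      _ = _ := by rw [mul_comm, ENNReal.ofReal_mul (by norm_num), ENNReal.ofReal_ofNat]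
  have h2 : ∫⁻ ω, ENNReal.ofReal (X ω ^ 2) ∂P = 0 := by
    refine le_antisymm ?_ zero_le
    have ht : Filter.Tendsto (fun K : ℝ => ENNReal.ofReal (2 * K ^ 2))
        (nhdsWithin 0 (Set.Ioi 0)) (nhds 0) := by
      have hc : Continuous fun K : ℝ => ENNReal.ofReal (2 * K ^ 2) :=
        ENNReal.continuous_ofReal.comp (by fun_prop)
      have := (hc.tendsto 0).mono_left (nhdsWithin_le_nhds (s := Set.Ioi 0))
      simpa using this
    exact ge_of_tendsto ht (eventually_nhdsWithin_of_forall fun K hK => h1 K hK)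
  rw [lintegral_eq_zero_iff (by fun_prop)] at h2
  filter_upwards [h2] with ω hω
  have : X ω ^ 2 ≤ 0 := by simpa using hω
  exact pow_eq_zero_iff two_ne_zero |>.1 (le_antisymm this (sq_nonneg _))

lemma psiTwoVec_lt_top {ξ : Fin n → Ω → ℝ} (h : ∀ i, psiNorm P 2 (ξ i) < ∞) :
    psiTwoVec P ξ < ∞ := by
  rw [psiTwoVec, ← Finset.sup_univ_eq_iSup, Finset.sup_lt_iff (by simp)]
  exact fun i _ => h i

end PsiNorm

end Chaos
end

/-! ### Assembly: moment bound and tail bound for matrices -/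

noncomputable section

namespace Chaos

variable {m n : ℕ}

lemma lpN_dev_col_le {𝒜 : Set (Matrix (Fin m) (Fin n) ℂ)} (hne : 𝒜.Nonempty) {p : ℝ} (hp : 1 ≤ p)
    (hr : radius ∞ 𝒜 ≠ ∞) (hγ : gammaTrunc 2 p (schattenDist ∞) 𝒜 ≠ ∞) :
    lpN p (stdGauss n)
        (fun x => ⨆ A ∈ 𝒜, ENNReal.ofReal |‖act (col A) x‖ ^ 2 - hsSq (col A)|) ≤
      ENNReal.ofReal 2097152 * (gammaTrunc 2 p (schattenDist ∞) 𝒜 ^ 2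
        + radius 2 𝒜 * gammaTrunc 2 p (schattenDist ∞) 𝒜
        + ENNReal.ofReal √p * radius 4 𝒜 ^ 2 + ENNReal.ofReal p * radius ∞ 𝒜 ^ 2) := by
  have hp0 : 0 < p := by linarith
  have hr2 : radius 2 𝒜 ≠ ∞ :=
    radius_ne_top_of_sq_le hr fun A => (schattenNorm_two_sq A).trans_le (hsSq_col_le A)
  have hr4 : radius 4 𝒜 ≠ ∞ := radius_ne_top_of_sq_le hr schattenNorm_four_sq_le
  set d : Matrix (Fin m) (Fin n) ℂ → Matrix (Fin m) (Fin n) ℂ → ℝ := schattenDist ∞ with hd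
  set g := (gammaTrunc 2 p d 𝒜).toReal with hg
  set D := (radius ∞ 𝒜).toReal with hD
  set D₂ := (radius 2 𝒜).toReal with hD₂
  set D₄ := (radius 4 𝒜).toReal with hD₄
  set l := ⌊Real.logb 2 p⌋₊ with hl
  have hlog : 0 ≤ Real.logb 2 p := Real.logb_nonneg (by norm_num) hp
  have hlp : (2 : ℝ) ^ l ≤ p := by
    rw [← Real.rpow_natCast, ← Real.le_logb_iff_rpow_le (by norm_num) hp0]
    exact Nat.floor_le hlog
  have hpl : p ≤ (2 : ℝ) ^ (l + 1) := by
    rw [← Real.rpow_natCast, ← Real.logb_le_iff_le_rpow (by norm_num) hp0]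
    push_cast
    exact (Nat.lt_floor_add_one _).le
  -- The infimum over admissible sequences need not be attained, so a sequence within `ε` is used
  -- and `ε` tends to zero afterwards.
  have key : ∀ ε : ℝ, 0 < ε → lpN p (stdGauss n)
        (fun x => ⨆ A ∈ 𝒜, ENNReal.ofReal |‖act (col A) x‖ ^ 2 - hsSq (col A)|) ≤
      ENNReal.ofReal
        (2097152 * ((g + ε) ^ 2 + D₂ * (g + ε) + √p * D₄ ^ 2 + p * D ^ 2)) := by
    intro ε hε
    have hlt : gammaTrunc 2 p d 𝒜 < ENNReal.ofReal (g + ε) := by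
      rw [ENNReal.lt_ofReal_iff_toReal_lt hγ]; linarith
    obtain ⟨T, hT⟩ := iInf_lt_iff.1 hlt
    obtain ⟨hadm, hT⟩ := iInf_lt_iff.1 hT
    refine lpN_dev_iSup_le hne (d := d) (T := fun j => T (l + j)) (l := l)
      (fun s t => schattenNorm_top_nonneg _) schattenDist_comm schattenDist_triangle
      (fun s t => ?_) ENNReal.toReal_nonneg
      (fun A hA => (opBound_col A).mono (schattenNorm_le_radius hr hA)) ENNReal.toReal_nonneg
      (fun A hA => ?_) (by positivity) (fun A hA => ?_) hp hlp hpl (fun j => hadm.subset _)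
      (fun j => ?_) (by positivity) (fun A hA => ?_)
    · rw [col_sub, hd, schattenDist_comm]
      exact opBound_col _
    · rw [← schattenNorm_two_sq]
      have h0 := schattenNorm_two_nonneg A
      have h1 := schattenNorm_le_radius hr2 hA
      gcongr
    · refine (sqrt_sum_inner_sq_le A).trans ?_
      have h0 := schattenNorm_four_nonneg A
      have h1 := schattenNorm_le_radius hr4 hA
      gcongr
    -- Level `0` has its own cardinality condition, and `1 ≤ 2 ^ 2 ^ 0`.
    · rcases Nat.eq_zero_or_pos (l + j) with h | h
      · simp only [h, hadm.card_zero]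
        norm_num
      · exact hadm.card_le _ h
    · refine le_trans ?_ ((le_iSup₂ (f := fun t (_ : t ∈ 𝒜) => ∑' k : Set.Ici l,
        (2 : ℝ≥0∞) ^ (((k : ℕ) : ℝ) / 2) * distTo d t (T k)) A hA).trans hT.le)
      have hinj : Function.Injective fun j : ℕ => (⟨l + j, Nat.le_add_right l j⟩ : Set.Ici l) :=
        fun i j h =>
        Nat.add_left_cancel (congrArg Subtype.val h)
      exact ENNReal.tsum_comp_le_tsum_of_injective hinj
        (fun k : Set.Ici l => (2 : ℝ≥0∞) ^ (((k : ℕ) : ℝ) / 2) * distTo d A (T k))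
  have hlim : Filter.Tendsto (fun ε : ℝ => ENNReal.ofReal
      (2097152 * ((g + ε) ^ 2 + D₂ * (g + ε) + √p * D₄ ^ 2 + p * D ^ 2)))
      (nhdsWithin 0 (Set.Ioi 0)) (nhds (ENNReal.ofReal
        (2097152 * (g ^ 2 + D₂ * g + √p * D₄ ^ 2 + p * D ^ 2)))) := by
    have hc : Continuous fun ε : ℝ => ENNReal.ofReal
        (2097152 * ((g + ε) ^ 2 + D₂ * (g + ε) + √p * D₄ ^ 2 + p * D ^ 2)) :=
      ENNReal.continuous_ofReal.comp (by fun_prop)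
    simpa using (hc.tendsto 0).mono_left (nhdsWithin_le_nhds (s := Set.Ioi 0))
  refine (ge_of_tendsto hlim (eventually_nhdsWithin_of_forall key)).trans (le_of_eq ?_)
  have hg0 : 0 ≤ g := ENNReal.toReal_nonneg
  have hD0 : 0 ≤ D := ENNReal.toReal_nonneg
  have hD20 : 0 ≤ D₂ := ENNReal.toReal_nonneg
  have hD40 : 0 ≤ D₄ := ENNReal.toReal_nonneg
  rw [ENNReal.ofReal_mul (by norm_num), ENNReal.ofReal_add (by positivity) (by positivity),
    ENNReal.ofReal_add (by positivity) (by positivity),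
    ENNReal.ofReal_add (by positivity) (by positivity), ENNReal.ofReal_mul hD20,
    ENNReal.ofReal_mul (by positivity), ENNReal.ofReal_mul hp0.le, ENNReal.ofReal_pow hg0,
    ENNReal.ofReal_pow hD0, ENNReal.ofReal_pow hD40, ENNReal.ofReal_toReal hγ,
    ENNReal.ofReal_toReal hr, ENNReal.ofReal_toReal hr2, ENNReal.ofReal_toReal hr4]

section SupDev

variable {Ω : Type*} [MeasurableSpace Ω] {P : Measure Ω}

lemma sqNorm_eq (ξ : Fin n → Ω → ℝ) (A : Matrix (Fin m) (Fin n) ℂ) (ω : Ω) :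
    sqNorm ξ A ω = ‖act (col A) fun j => ξ j ω‖ ^ 2 := by
  rw [act_col, sqNorm]

lemma measurable_supDev {ξ : Fin n → Ω → ℝ} (hm : ∀ i, Measurable (ξ i))
    (𝒜 : Set (Matrix (Fin m) (Fin n) ℂ)) : Measurable (supDev P ξ 𝒜) := by
  have h := (lowerSemicontinuous_iSup_ofReal_abs 𝒜
    (f := fun A (x : Fin n → ℝ) => ‖act (col A) x‖ ^ 2 - ∫ ω', sqNorm ξ A ω' ∂P)
    fun A => ((continuous_act (col A)).norm.pow 2).sub continuous_const).measurable
  have e : supDev P ξ 𝒜 = (fun x : Fin n → ℝ => ⨆ A ∈ 𝒜,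
      ENNReal.ofReal |‖act (col A) x‖ ^ 2 - ∫ ω', sqNorm ξ A ω' ∂P|) ∘ fun ω j => ξ j ω := by
    ext ω; simp only [supDev, sqNorm_eq, Function.comp_apply]
  rw [e]
  exact h.comp (measurable_pi_lambda _ hm)

lemma supDev_ae_eq_zero {ξ : Fin n → Ω → ℝ} (h : ∀ i, ξ i =ᵐ[P] 0)
    (𝒜 : Set (Matrix (Fin m) (Fin n) ℂ)) : supDev P ξ 𝒜 =ᵐ[P] 0 := by
  have h1 : ∀ᵐ ω ∂P, ∀ i, ξ i ω = 0 := ae_all_iff.2 h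
  have h2 : ∀ A : Matrix (Fin m) (Fin n) ℂ, ∫ ω, sqNorm ξ A ω ∂P = 0 := fun A => by
    refine integral_eq_zero_of_ae ?_
    filter_upwards [h1] with ω hω
    simp [sqNorm_eq, hω, act]
  filter_upwards [h1] with ω hω
  simp only [supDev, h2]
  simp [sqNorm_eq, hω, act]

variable [IsProbabilityMeasure P]

/-- Moments of the chaos process, with an explicit constant. -/
lemma lpN_supDev_le {ξ : Fin n → Ω → ℝ} (𝒜 : Set (Matrix (Fin m) (Fin n) ℂ))
    (hm : ∀ i, Measurable (ξ i)) (hind : iIndepFun ξ P) (hmean : ∀ i, ∫ ω, ξ i ω ∂P = 0)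
    (hψ : ∀ i, psiNorm P 2 (ξ i) < ∞) {p : ℝ} (hp : 1 ≤ p) :
    lpN p P (supDev P ξ 𝒜) ≤ ENNReal.ofReal 5242880000 * psiTwoVec P ξ ^ 2 *
      (gammaTrunc 2 p (schattenDist ∞) 𝒜 ^ 2 + radius 2 𝒜 * gammaTrunc 2 p (schattenDist ∞) 𝒜
        + ENNReal.ofReal √p * radius 4 𝒜 ^ 2 + ENNReal.ofReal p * radius ∞ 𝒜 ^ 2) := by
  have hp0 : 0 < p := by linarith
  have hψt : psiTwoVec P ξ ≠ ∞ := (psiTwoVec_lt_top hψ).ne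
  have hi : ∀ i, psiNorm P 2 (ξ i) ≤ psiTwoVec P ξ := fun i => le_iSup (fun i => psiNorm P 2 (ξ i)) i
  -- Since `0 * ∞ = 0`, this case must be settled separately: the deviation vanishes almost surely.
  -- Once the prefactor is non-zero, an infinite radius or functional makes the right side `∞`.
  by_cases hψ0 : psiTwoVec P ξ = 0
  · have h0 := supDev_ae_eq_zero (P := P) (ξ := ξ) (fun i => ae_eq_zero_of_psiNorm_eq_zero (hm i)
      (le_antisymm ((hi i).trans hψ0.le) zero_le)) 𝒜
    rw [lpN_le_iff hp, lintegral_congr_ae (g := 0)]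
    · simp
    · filter_upwards [h0] with ω hω
      simp [hω, hp0]
  rcases 𝒜.eq_empty_or_nonempty with rfl | hne
  · rw [lpN_le_iff hp]
    simp [supDev, hp0]
  have hc0 : ENNReal.ofReal 5242880000 * psiTwoVec P ξ ^ 2 ≠ 0 :=
    mul_ne_zero (by simp) (pow_ne_zero 2 hψ0)
  by_cases hr : radius ∞ 𝒜 = ∞
  · rw [hr, ENNReal.top_pow two_ne_zero, ENNReal.mul_top (by simpa using hp0), add_top,
      ENNReal.mul_top hc0]
    exact le_top
  by_cases hγ : gammaTrunc 2 p (schattenDist ∞) 𝒜 = ∞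
  · rw [hγ, ENNReal.top_pow two_ne_zero, top_add, top_add, top_add, ENNReal.mul_top hc0]
    exact le_top
  set ψ := (psiTwoVec P ξ).toReal with hψdef
  have hψpos : 0 < ψ := ENNReal.toReal_pos hψ0 hψt
  -- Scaling by `2 ψ` supplies the strict inequality. The total constant is `625 * 4 * 2097152`.
  have hexp : ∀ i, ∫⁻ ω, ENNReal.ofReal (Real.exp ((ξ i ω / (2 * ψ)) ^ 2)) ∂P ≤ 2 := fun i => by
    refine lintegral_exp_le_two_of_psiNorm_lt ((hi i).trans_lt ?_)
    rw [ENNReal.lt_ofReal_iff_toReal_lt hψt]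
    linarith
  have h1 := lintegral_iSup_le_gaussian (P := P) hm hind hmean (by positivity : 0 < 2 * ψ) hexp 𝒜
    col hp
  have h2 : lpN p P (supDev P ξ 𝒜) ≤ ENNReal.ofReal (625 * (2 * ψ) ^ 2) * lpN p (stdGauss n)
      (fun x => ⨆ A ∈ 𝒜, ENNReal.ofReal |‖act (col A) x‖ ^ 2 - hsSq (col A)|) := by
    rw [lpN_le_iff hp, ENNReal.mul_rpow_of_nonneg _ _ hp0.le, lpN_rpow hp]
    simpa only [supDev, sqNorm_eq] using h1
  refine (h2.trans (mul_le_mul_right (lpN_dev_col_le hne hp hr hγ) _)).trans (le_of_eq ?_)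
  rw [← mul_assoc, ← ENNReal.ofReal_toReal hψt, ← hψdef, ← ENNReal.ofReal_pow hψpos.le,
    ← ENNReal.ofReal_mul (by positivity), ← ENNReal.ofReal_mul (by norm_num)]
  congr 2
  ring

/-- Markov's inequality for the `u`-th power at the level `e * B`. Cancelling `B ^ u` needs `0 < B <
∞`, which is why the tail bound assumes non-degenerate data. -/
lemma measure_le_exp_neg_of_lpN_le {f : Ω → ℝ≥0∞} (hf : Measurable f) {u : ℝ} (hu : 1 ≤ u)
    {B : ℝ≥0∞} (hB0 : B ≠ 0) (hB : B ≠ ∞) (h : lpN u P f ≤ B) :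
    P {ω | ENNReal.ofReal (Real.exp 1) * B ≤ f ω} ≤ ENNReal.ofReal (Real.exp (-u)) := by
  have hu0 : 0 < u := by linarith
  have h1 := mul_meas_ge_le_lintegral (μ := P) (hf.pow_const u)
    ((ENNReal.ofReal (Real.exp 1) * B) ^ u)
  simp only [ENNReal.rpow_le_rpow_iff hu0] at h1
  have h2 := h1.trans ((lpN_le_iff hu).1 h)
  have hBu0 : B ^ u ≠ 0 := by simp [ENNReal.rpow_eq_zero_iff, hB0, hB]
  have hBu : B ^ u ≠ ∞ := ENNReal.rpow_ne_top_of_nonneg hu0.le hB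
  have hE : ENNReal.ofReal (Real.exp 1) ^ u = ENNReal.ofReal (Real.exp u) := by
    rw [ENNReal.ofReal_rpow_of_pos (Real.exp_pos 1), ← Real.exp_mul, one_mul]
  rw [ENNReal.mul_rpow_of_nonneg _ _ hu0.le, hE, mul_comm (ENNReal.ofReal _), mul_assoc] at h2
  have h3 := (ENNReal.mul_le_mul_iff_right hBu0 hBu).1 (h2.trans_eq (mul_one _).symm)
  rw [Real.exp_neg, ENNReal.ofReal_inv_of_pos (Real.exp_pos u), ← one_div,
    ENNReal.le_div_iff_mul_le (by simp [Real.exp_pos]) (by simp), mul_comm]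
  exact h3

end SupDev

end Chaos
end

theorem theorem6p5 :
    (∃ C : ℝ, 0 < C ∧
      ∀ (Ω : Type*) [MeasurableSpace Ω] (P : Measure Ω) [IsProbabilityMeasure P] (m n : ℕ)
        (ξ : Fin n → Ω → ℝ) (𝒜 : Set (Matrix (Fin m) (Fin n) ℂ)),
        (∀ i, Measurable (ξ i)) → iIndepFun ξ P → (∀ i, ∫ ω, ξ i ω ∂P = 0) →
        (∀ i, Chaos.psiNorm P 2 (ξ i) < ∞) →
        ∀ p : ℝ, 1 ≤ p →
          (∫⁻ ω, Chaos.supDev P ξ 𝒜 ω ^ p ∂P) ^ (1 / p) ≤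
            ENNReal.ofReal C * Chaos.psiTwoVec P ξ ^ 2 *
              (Chaos.gammaTrunc 2 p (Chaos.schattenDist ∞) 𝒜 ^ 2
                + Chaos.radius 2 𝒜 * Chaos.gammaTrunc 2 p (Chaos.schattenDist ∞) 𝒜
                + ENNReal.ofReal (Real.sqrt p) * Chaos.radius 4 𝒜 ^ 2
                + ENNReal.ofReal p * Chaos.radius ∞ 𝒜 ^ 2)) ∧
    (∃ c C : ℝ, 0 < c ∧ 0 < C ∧
      ∀ (Ω : Type*) [MeasurableSpace Ω] (P : Measure Ω) [IsProbabilityMeasure P] (m n : ℕ)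
        (ξ : Fin n → Ω → ℝ) (𝒜 : Set (Matrix (Fin m) (Fin n) ℂ)),
        (∀ i, Measurable (ξ i)) → iIndepFun ξ P → (∀ i, ∫ ω, ξ i ω ∂P = 0) →
        (∀ i, Chaos.psiNorm P 2 (ξ i) < ∞) →
        Chaos.gammaFun 2 (Chaos.schattenDist ∞) 𝒜 < ∞ →
        (∃ A ∈ 𝒜, A ≠ 0) → (∃ i, ¬ ξ i =ᵐ[P] 0) →
        ∀ u : ℝ, 1 ≤ u →
          P {ω | ENNReal.ofReal C * Chaos.psiTwoVec P ξ ^ 2 *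
                  (Chaos.gammaFun 2 (Chaos.schattenDist ∞) 𝒜 ^ 2
                    + Chaos.radius 2 𝒜 * Chaos.gammaFun 2 (Chaos.schattenDist ∞) 𝒜)
                + ENNReal.ofReal c * Chaos.psiTwoVec P ξ ^ 2 *
                  (ENNReal.ofReal (Real.sqrt u) * Chaos.radius 4 𝒜 ^ 2
                    + ENNReal.ofReal u * Chaos.radius ∞ 𝒜 ^ 2)
              ≤ Chaos.supDev P ξ 𝒜 ω}
            ≤ ENNReal.ofReal (Real.exp (-u))) := by
  refine ⟨⟨5242880000, by norm_num, ?_⟩,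
    ⟨Real.exp 1 * 5242880000, Real.exp 1 * 5242880000, by positivity, by positivity, ?_⟩⟩
  · intro Ω _ P _ m n ξ 𝒜 hm hind hmean hψ p hp
    exact Chaos.lpN_supDev_le 𝒜 hm hind hmean hψ hp
  · intro Ω _ P _ m n ξ 𝒜 hm hind hmean hψ hγ hA hξ u hu
    obtain ⟨A, hA, hA0⟩ := hA
    obtain ⟨i, hi⟩ := hξ
    have hu0 : 0 < u := by linarith
    have hr := Chaos.radius_top_ne_top hγ
    have hr2 : Chaos.radius 2 𝒜 ≠ ∞ := Chaos.radius_ne_top_of_sq_le hr fun A =>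
      (Chaos.schattenNorm_two_sq A).trans_le (Chaos.hsSq_col_le A)
    have hr4 : Chaos.radius 4 𝒜 ≠ ∞ :=
      Chaos.radius_ne_top_of_sq_le hr Chaos.schattenNorm_four_sq_le
    have hr0 : Chaos.radius ∞ 𝒜 ≠ 0 := by
      refine (lt_of_lt_of_le (ENNReal.ofReal_pos.2 (Chaos.schattenNorm_top_pos hA0)) ?_).ne'
      exact le_iSup₂ (f := fun A (_ : A ∈ 𝒜) => ENNReal.ofReal (Chaos.schattenNorm ∞ A)) A hA
    have hψt : Chaos.psiTwoVec P ξ ≠ ∞ := (Chaos.psiTwoVec_lt_top hψ).ne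
    have hψ0 : Chaos.psiTwoVec P ξ ≠ 0 := fun h => hi <|
      Chaos.ae_eq_zero_of_psiNorm_eq_zero (hm i) <| le_antisymm
        ((le_iSup (fun i => Chaos.psiNorm P 2 (ξ i)) i).trans h.le) zero_le
    set ψ := Chaos.psiTwoVec P ξ
    set γ := Chaos.gammaFun 2 (Chaos.schattenDist ∞) 𝒜
    have hle : Chaos.gammaTrunc 2 u (Chaos.schattenDist ∞) 𝒜 ≤ γ :=
      Chaos.gammaTrunc_le_gammaFun _ _ _ _
    -- The moment order is `p = u`. Replacing the truncated functional by the full one makes the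
    -- chaining term independent of `u`.
    have hB := Chaos.measure_le_exp_neg_of_lpN_le (P := P) (Chaos.measurable_supDev hm 𝒜) hu
      (B := ENNReal.ofReal 5242880000 * ψ ^ 2 * (γ ^ 2 + Chaos.radius 2 𝒜 * γ
        + ENNReal.ofReal √u * Chaos.radius 4 𝒜 ^ 2 + ENNReal.ofReal u * Chaos.radius ∞ 𝒜 ^ 2))
      ?_ ?_ ((Chaos.lpN_supDev_le 𝒜 hm hind hmean hψ hu).trans (by gcongr))
    · refine le_trans (le_of_eq ?_) hB
      congr 2
      ext ω
      rw [ENNReal.ofReal_mul (Real.exp_pos 1).le]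
      ring_nf
    · refine mul_ne_zero (mul_ne_zero (by simp) (pow_ne_zero 2 hψ0)) ?_
      simp [hr0, hu0]
    · have h1 : ψ ^ 2 ≠ ∞ := ENNReal.pow_ne_top hψt
      have h2 : γ ^ 2 ≠ ∞ := ENNReal.pow_ne_top hγ.ne
      have h3 : Chaos.radius 4 𝒜 ^ 2 ≠ ∞ := ENNReal.pow_ne_top hr4
      have h4 : Chaos.radius ∞ 𝒜 ^ 2 ≠ ∞ := ENNReal.pow_ne_top hr
      have h5 : Chaos.radius 2 𝒜 * γ ≠ ∞ := ENNReal.mul_ne_top hr2 hγ.ne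
      have h6 : ENNReal.ofReal √u * Chaos.radius 4 𝒜 ^ 2 ≠ ∞ :=
        ENNReal.mul_ne_top ENNReal.ofReal_ne_top h3
      have h7 : ENNReal.ofReal u * Chaos.radius ∞ 𝒜 ^ 2 ≠ ∞ :=
        ENNReal.mul_ne_top ENNReal.ofReal_ne_top h4
      exact ENNReal.mul_ne_top (ENNReal.mul_ne_top ENNReal.ofReal_ne_top h1)
        (ENNReal.add_ne_top.2 ⟨ENNReal.add_ne_top.2 ⟨ENNReal.add_ne_top.2 ⟨h2, h5⟩, h6⟩, h7⟩)
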